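/- Let $n,k,r$ be nonnegative integers with $r\le n$. Let $I_{n,k,r}\subseteq\mathbb{Q}[x_1,\dots,x_n]$ be the ideal generated by the complete homogeneous symmetric polynomials $h_{k+1},h_{k+2},\dots,h_{k+n}$ and the elementary symmetric polynomials $e_{n-r+1},\dots,e_{n-1},e_n$ in the variables $x_1,\dots,x_n$, and let $R_{n,k,r}=\mathbb{Q}[x_1,\dots,x_n]/I_{n,k,r}$, graded by degree. For $S=\{s_1<\cdots<s_m\}\subseteq\{1,\dots,n\}$ let $x(S)=x_{s_1}^{s_1}x_{s_2}^{s_2-1}\cdots x_{s_m}^{s_m-m+1}$. Let $\mathcal{M}_{n,k,r}$ be the set of monomials in $x_1,\dots,x_n$ that are divisible by no $x(S)$ with $|S|=n-r+1$ and by no $x_i^{k+i}$ with $1\le i\le n$ (the $(n,k,r)$-good monomials). 1. With respect to the lexicographic term order ($x_1^{a_1}\cdots x_n^{a_n}<x_1^{b_1}\cdots x_n^{b_n}$ if $a_i<b_i$ at the first index $i$ at which the exponents differ), the set of standard monomials of $I_{n,k,r}$, that is, the set of monomials not divisible by the leading term of any nonzero $f\in I_{n,k,r}$, is $\mathcal{M}_{n,k,r}$;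 and the classes of the monomials in $\mathcal{M}_{n,k,r}$ form a $\mathbb{Q}$-basis of $R_{n,k,r}$. 2. The Hilbert series of $R_{n,k,r}$ is $$\sum_{d\ge 0}\dim_{\mathbb{Q}}\bigl((R_{n,k,r})_d\bigr)\,q^d=\binom{n+k-r}{k}_{\!q}\cdot[n]!_q,$$ where $[m]!_q=\prod_{i=1}^m(1+q+\cdots+q^{i-1})$ and $\binom{m}{i}_q=\frac{[m]!_q}{[i]!_q\,[m-i]!_q}$. 3. Let $S_{n,k,r}$ be the set of words $\pi=\pi_1\cdots\pi_{n+k}$ that are rearrangements of the multiset $\{0^k,1,2,\dots,n\}$ and whose last $r$ letters are positive. For $\pi\in S_{n,k,r}$ and $1\le i\le n$ let $c_i$ be the number of letters among $0,1,\dots,i-1$ that stand to the right of $i$ in $\pi$. Then $\pi\mapsto x_1^{c_1}\cdots x_n^{c_n}$ is a bijection from $S_{n,k,r}$ onto $\mathcal{M}_{n,k,r}$. -/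

import Mathlib

namespace TailPositive

open MvPolynomial

noncomputable section

/-! ### The ring

Variables are indexed by `Fin n`; the index `i : Fin n` stands for the variable `x_{i+1}`.
A monomial is given by its exponent vector `m : Fin n →₀ ℕ`, the corresponding polynomial being
`monomial m 1`. -/

/-- The ideal `I_{n,k,r}` of `ℚ[x_1, …, x_n]` generated by the complete homogeneous symmetric
polynomials `h_{k+1}, …, h_{k+n}` and the elementary symmetric polynomials
`e_{n-r+1}, …, e_n` in all `n` variables (meant for `r ≤ n`). -/
def idealI (n k r : ℕ) : Ideal (MvPolynomial (Fin n) ℚ) :=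
  Ideal.span
    ((fun d => hsymm (Fin n) ℚ d) '' Set.Icc (k + 1) (k + n) ∪
      (fun d => esymm (Fin n) ℚ d) '' Set.Icc (n - r + 1) n)

/-- The quotient ring `R_{n,k,r} = ℚ[x_1, …, x_n] / I_{n,k,r}`. -/
abbrev ringR (n k r : ℕ) : Type := MvPolynomial (Fin n) ℚ ⧸ idealI n k r

/-- The image of a polynomial in `ℚ[x_1, …, x_n] / I`, as a `ℚ`-linear map. -/
abbrev quotMap {n : ℕ} (I : Ideal (MvPolynomial (Fin n) ℚ)) :
    MvPolynomial (Fin n) ℚ →ₗ[ℚ] MvPolynomial (Fin n) ℚ ⧸ I :=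
  (Ideal.Quotient.mkₐ ℚ I).toLinearMap

attribute [local instance] MvPolynomial.gradedAlgebra

/-- The ideal is homogeneous, so the degree on polynomials induces a grading of the quotient. -/
theorem idealI_isHomogeneous (n k r : ℕ) :
    (idealI n k r).IsHomogeneous (homogeneousSubmodule (Fin n) ℚ) := by
  refine Ideal.homogeneous_span _ _ ?_
  rintro _ (⟨d, -, rfl⟩ | ⟨d, -, rfl⟩)
  · refine ⟨d, ?_⟩
    rw [mem_homogeneousSubmodule]
    refine IsHomogeneous.sum _ _ _ fun s _ => ?_
    have key : ∀ t : Multiset (Fin n),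
        ((t.map (X : Fin n → MvPolynomial (Fin n) ℚ)).prod).IsHomogeneous (Multiset.card t) := by
      intro t
      induction t using Multiset.induction_on with
      | empty => simpa using isHomogeneous_one (Fin n) ℚ
      | cons a t ih =>
        rw [Multiset.map_cons, Multiset.prod_cons, Multiset.card_cons, add_comm]
        exact (isHomogeneous_X ℚ a).mul ih
    have h := key s.1
    rw [s.2] at h
    exact h
  · refine ⟨d, ?_⟩
    rw [mem_homogeneousSubmodule]
    refine IsHomogeneous.sum _ _ _ fun t ht => ?_
    have h := IsHomogeneous.prod t (fun i => (X i : MvPolynomial (Fin n) ℚ)) (fun _ => 1)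
      (fun i _ => isHomogeneous_X ℚ i)
    simpa [(Finset.mem_powersetCard.mp ht).2] using h

/-- The degree `d` component of `ℚ[x_1, …, x_n] / I`, for a homogeneous ideal `I`: the classes
of the homogeneous polynomials of degree `d`. -/
def gradedPiece {n : ℕ} (I : Ideal (MvPolynomial (Fin n) ℚ)) (d : ℕ) :
    Submodule ℚ (MvPolynomial (Fin n) ℚ ⧸ I) :=
  (homogeneousSubmodule (Fin n) ℚ d).map (quotMap I)

/-- The Hilbert series `∑_d dim_ℚ (ℚ[x_1, …, x_n] / I)_d q^d`, for a homogeneous ideal `I`. -/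
def hilbertSeries {n : ℕ} (I : Ideal (MvPolynomial (Fin n) ℚ)) : PowerSeries ℚ :=
  PowerSeries.mk fun d => (Module.finrank ℚ (gradedPiece I d) : ℚ)

/-! ### Standard monomials -/

/-- The standard monomials of an ideal `I` for a term order: the monomials that are divisible by
the leading term of no nonzero element of `I`. -/
def standardMonomials {n : ℕ} (ord : MonomialOrder (Fin n))
    (I : Ideal (MvPolynomial (Fin n) ℚ)) : Set (Fin n →₀ ℕ) :=
  {m | ∀ f ∈ I, f ≠ 0 → ¬ ord.leadingTerm f ∣ monomial m (1 : ℚ)}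

/-! ### Good monomials -/

/-- The skip monomial `x(S) = x_{s_1}^{s_1} x_{s_2}^{s_2-1} ⋯ x_{s_m}^{s_m-m+1}` of
`S = {s_1 < ⋯ < s_m}`. For `s_j` with 0-based index `i`, one has `s_j = i + 1` and `j - 1` is the
number of elements of `S` below `i`; this number is at most `i`. -/
def skipMonomial {n : ℕ} (S : Finset (Fin n)) : MvPolynomial (Fin n) ℚ :=
  ∏ i ∈ S, X i ^ ((i : ℕ) + 1 - (S.filter (· < i)).card)

/-- The `(n,k,r)`-good monomials: those divisible by no `x(S)` with `|S| = n - r + 1` and by no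
`x_i^{k+i}`, `1 ≤ i ≤ n` (meant for `r ≤ n`). -/
def goodMonomials (n k r : ℕ) : Set (Fin n →₀ ℕ) :=
  {m | (∀ S : Finset (Fin n), S.card = n - r + 1 → ¬ skipMonomial S ∣ monomial m (1 : ℚ)) ∧
    ∀ i : Fin n, ¬ (X i : MvPolynomial (Fin n) ℚ) ^ (k + ((i : ℕ) + 1)) ∣ monomial m (1 : ℚ)}

/-! ### Tail positive words and codes -/

/-- A word is `r`-tail positive if its last `r` letters are positive. -/
def IsTailPositive {N : ℕ} (r : ℕ) (w : Fin N → ℕ) : Prop :=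
  ∀ p : Fin N, N - r ≤ (p : ℕ) → 0 < w p

/-- The set `S_{n,k,r}` of `r`-tail positive permutations (rearrangements) of the multiset
`{0^k, 1, 2, …, n}`, as words of length `n + k`. -/
def tailPositiveWords (n k r : ℕ) : Set (Fin (n + k) → ℕ) :=
  {w | Finset.univ.val.map w = Multiset.replicate k 0 + (Finset.Icc 1 n).val ∧
    IsTailPositive r w}

/-- The code `(c_1, …, c_n)` of a word containing each of the letters `1, …, n` once: `c_i` is the
number of letters among `0, 1, …, i - 1` standing to the right of `i`. It is read as the monomial
`x_1^{c_1} ⋯ x_n^{c_n}`. -/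
def code (n k : ℕ) (w : Fin (n + k) → ℕ) : Fin n →₀ ℕ :=
  Finsupp.equivFunOnFinite.symm fun i =>
    {q : Fin (n + k) | w q < (i : ℕ) + 1 ∧ ∃ p < q, w p = (i : ℕ) + 1}.ncard

/-! ### `q`-analogues, as power series in `q` -/

/-- `[m]_q = 1 + q + ⋯ + q^{m-1}`. -/
def qNumber (m : ℕ) : PowerSeries ℚ := ∑ j ∈ Finset.range m, PowerSeries.X ^ j

/-- `[m]!_q = [1]_q [2]_q ⋯ [m]_q`. -/
def qFactorial (m : ℕ) : PowerSeries ℚ := ∏ i ∈ Finset.range m, qNumber (i + 1)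

/-- The constant term of `[m]!_q` is `1`, so `[m]!_q` is an invertible power series. -/
theorem constantCoeff_qFactorial (m : ℕ) : PowerSeries.constantCoeff (qFactorial m) = 1 := by
  simp only [qFactorial, map_prod]
  refine Finset.prod_eq_one fun i _ => ?_
  simp [qNumber, Finset.sum_range_succ']

/-- The `q`-binomial coefficient `[m]!_q / ([i]!_q [m-i]!_q)` for `i ≤ m`, and `0` for `i > m`.
The quotient is taken in `ℚ⟦q⟧`, where the denominator is invertible. -/
def qBinomial (m i : ℕ) : PowerSeries ℚ :=
  if i ≤ m then qFactorial m * (qFactorial i * qFactorial (m - i))⁻¹ else 0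

end

end TailPositive

/-!
The proof squeezes the quotient `R = ℚ[x_1, …, x_n] / I` between two bounds that meet.

*Standard monomials are good.* For each of the forbidden divisors, `I` contains an element with that
lexicographic leading monomial. For `x_i^{k+i}` it is `h_{k+i}(x_i, …, x_n)`
(`exists_isLexLead_hIdeal`). For `x(S)` the argument runs by induction on the number of variables
in a larger family of ideals: `minorIdeal n c m` is generated by the `c × c` minors of the Toeplitz
matrix with rows `(e_p, …, e_{p+c-1})`, `p ≥ m - c + 1`, and contains, for each `S` with
`|S| = m`, an element with leading monomial `x(S) ∏_{s ∈ S} x_s^{c-1}`. Splitting off the first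
variable `x` by `e_p = e_p' + x e_{p-1}'`, there are two cases. If `x` is not in `S`, the
`(c+1)`-minors in the remaining variables lie in the ideal of `c`-minors in all variables, by column
operations (`minorIdeal_map_le`). If `x` is in `S`, the coefficient of `x ^ c` in a `c`-minor is a
`c`-minor in the remaining variables, for `m - 1` in place of `m`
(`exists_leadingCoeff_minorIdeal`). The case `c = 1` is the one needed. Hence the good monomials
span `R`, degree by degree.

*There are enough good monomials to be independent.* A word of length `n + k` gives the point of
`ℚ^n` whose coordinates are the positions of the letters `1, …, n`. On the points of tail positive
words, each generator of `I` agrees with a polynomial of lower degree, because suitable multiples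
of the generating functions of the `h_d` and the `e_d` become polynomials of degree `k` and `n - r`.
So the good monomials, which span `R` degree by degree, also span the functions on these
points; being as many as the points, they are independent as functions, and then, comparing top
degrees, independent in `R` (`linearIndependent_quotMap_of_degeneration`).

*Counting.* Removing the letter `n` from a word deletes the last entry `c_n` of its code, and
a good exponent vector decomposes in the same way according to whether its last entry is less than
`r` (`skipFree_succ`). This gives the bijection with words (`bijOn_code`) and a recursion for the
generating function of good monomials, solved by the `q`-analogue (`skipFreeSeries_eq`).
-/

namespace TailPositive

open MvPolynomial

noncomputable section

attribute [local instance] MvPolynomial.gradedAlgebra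

/-! ### Splitting off the first variable -/

theorem esymm_succ (n p : ℕ) :
    esymm (Fin (n + 1)) ℚ (p + 1) =
      rename Fin.succ (esymm (Fin n) ℚ (p + 1)) + X 0 * rename Fin.succ (esymm (Fin n) ℚ p) := by
  classical
  simp only [esymm, map_sum, map_prod, rename_X]
  rw [Fin.univ_succ, Finset.cons_eq_insert, Finset.powersetCard_succ_insert (by simp),
    Finset.sum_union, Finset.powersetCard_map, Finset.sum_map, Finset.sum_image,
    Finset.powersetCard_map, Finset.sum_map, Finset.mul_sum]
  · congr 1
    · simp
    · refine Finset.sum_congr rfl fun t _ => ?_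
      change ∏ i ∈ insert 0 (t.map ⟨Fin.succ, Fin.succ_injective n⟩), X i = _
      rw [Finset.prod_insert (by simp), Finset.prod_map]
      rfl
  · intro a ha b hb hab
    have h0 : ∀ s ∈ Finset.powersetCard p (Finset.univ.map ⟨Fin.succ, Fin.succ_injective n⟩),
        (0 : Fin (n + 1)) ∉ s := by
      intro s hs h
      have := (Finset.mem_powersetCard.mp hs).1 h
      simp at this
    have := congrArg (fun s => s.erase 0) hab
    simpa [Finset.erase_insert (h0 a ha), Finset.erase_insert (h0 b hb)] using this
  · rw [Finset.disjoint_left]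
    intro s hs hs'
    obtain ⟨t, -, rfl⟩ := Finset.mem_image.mp hs'
    have := (Finset.mem_powersetCard.mp hs).1 (Finset.mem_insert_self 0 t)
    simp at this

theorem hsymm_option_succ (σ : Type*) [Fintype σ] [DecidableEq σ] (d : ℕ) :
    hsymm (Option σ) ℚ (d + 1) =
      rename some (hsymm σ ℚ (d + 1)) + X none * hsymm (Option σ) ℚ d := by
  simp only [hsymm, map_sum]
  rw [← (symOptionSuccEquiv (α := σ) (n := d)).symm.sum_comp, Fintype.sum_sum_type, add_comm,
    Finset.mul_sum]
  congr 1
  · refine Finset.sum_congr rfl fun s _ => ?_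
    simp [symOptionSuccEquiv, map_multiset_prod, Multiset.map_map]
  · refine Finset.sum_congr rfl fun s _ => ?_
    change (Multiset.map X (none ::ₘ s.1)).prod = X none * (s.1.map X).prod
    rw [Multiset.map_cons, Multiset.prod_cons]

theorem hsymm_succ (n d : ℕ) :
    hsymm (Fin (n + 1)) ℚ (d + 1) =
      rename Fin.succ (hsymm (Fin n) ℚ (d + 1)) + X 0 * hsymm (Fin (n + 1)) ℚ d := by
  have h := congrArg (rename (finSuccEquiv n).symm) (hsymm_option_succ (Fin n) d)
  rw [map_add, map_mul, rename_hsymm, rename_hsymm, rename_rename, rename_X] at h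
  simpa [Function.comp_def] using h

theorem hsymm_fin_zero (d : ℕ) : hsymm (Fin 0) ℚ (d + 1) = 0 := by
  simp [hsymm]

theorem finSuccEquiv_rename_succ {n : ℕ} (f : MvPolynomial (Fin n) ℚ) :
    MvPolynomial.finSuccEquiv ℚ n (rename Fin.succ f) = Polynomial.C f := by
  induction f using MvPolynomial.induction_on with
  | C a =>
    rw [rename_C]
    simp [MvPolynomial.finSuccEquiv_apply]
  | add p q hp hq => simp [hp, hq]
  | mul_X p i hp => rw [map_mul, map_mul, hp, rename_X, finSuccEquiv_X_succ, map_mul]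

/-! ### Lexicographic leading monomials -/

/-- `m` is the lexicographically largest monomial occurring in `f`. -/
def IsLexLead {n : ℕ} (f : MvPolynomial (Fin n) ℚ) (m : Fin n →₀ ℕ) : Prop :=
  coeff m f ≠ 0 ∧ ∀ m', coeff m' f ≠ 0 → toLex m' ≤ toLex m

theorem IsLexLead.ne_zero {n : ℕ} {f : MvPolynomial (Fin n) ℚ} {m : Fin n →₀ ℕ}
    (h : IsLexLead f m) : f ≠ 0 := by
  rintro rfl
  exact h.1 (coeff_zero m)

theorem IsLexLead.degree_eq {n : ℕ} {f : MvPolynomial (Fin n) ℚ} {m : Fin n →₀ ℕ}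
    (h : IsLexLead f m) : MonomialOrder.lex.degree f = m := by
  have h1 : MonomialOrder.lex.toSyn m ≤ MonomialOrder.lex.toSyn (MonomialOrder.lex.degree f) :=
    MonomialOrder.lex.le_degree (mem_support_iff.mpr h.1)
  have h2 : MonomialOrder.lex.toSyn (MonomialOrder.lex.degree f) ≤ MonomialOrder.lex.toSyn m :=
    MonomialOrder.lex.degree_le_iff.mpr fun c hc => h.2 c (mem_support_iff.mp hc)
  exact MonomialOrder.lex.toSyn.injective (le_antisymm h2 h1)

theorem toLex_cons_le_cons {n : ℕ} {i j : ℕ} {a b : Fin n →₀ ℕ}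
    (h : i < j ∨ i = j ∧ toLex a ≤ toLex b) :
    toLex (Finsupp.cons i a) ≤ toLex (Finsupp.cons j b) := by
  rcases h with h | ⟨rfl, h⟩
  · refine le_of_lt (Finsupp.Lex.lt_iff.mpr ⟨0, fun l hl => absurd hl (by simp), by simpa using h⟩)
  · rcases h.eq_or_lt with h | h
    · rw [toLex_inj.mp h]
    · obtain ⟨l, hl, hlt⟩ := Finsupp.Lex.lt_iff.mp h
      refine le_of_lt (Finsupp.Lex.lt_iff.mpr ⟨l.succ, fun q => ?_, by simpa using hlt⟩)
      refine Fin.cases (by simp) (fun q hq => ?_) q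
      simpa using hl q (by simpa using hq)

/-- A polynomial whose leading coefficient with respect to the first variable `x` is `g x ^ c`
inherits its lexicographic leading monomial from `g`. -/
theorem IsLexLead.cons {n c : ℕ} {f : MvPolynomial (Fin (n + 1)) ℚ} {g : MvPolynomial (Fin n) ℚ}
    {m : Fin n →₀ ℕ} (hdeg : (MvPolynomial.finSuccEquiv ℚ n f).natDegree ≤ c)
    (hcoeff : (MvPolynomial.finSuccEquiv ℚ n f).coeff c = g) (hg : IsLexLead g m) :
    IsLexLead f (Finsupp.cons c m) := by
  refine ⟨by rw [← finSuccEquiv_coeff_coeff, hcoeff]; exact hg.1, fun m' hm' => ?_⟩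
  rw [← Finsupp.cons_tail m', ← finSuccEquiv_coeff_coeff] at hm'
  rw [← Finsupp.cons_tail m']
  apply toLex_cons_le_cons
  have hle : m' 0 ≤ c := by
    by_contra h
    exact hm' (by rw [Polynomial.coeff_eq_zero_of_natDegree_lt (by omega), coeff_zero])
  rcases hle.lt_or_eq with h | h
  · exact Or.inl h
  · refine Or.inr ⟨h, hg.2 _ ?_⟩
    rwa [h, hcoeff] at hm'

theorem IsLexLead.rename_succ {n : ℕ} {g : MvPolynomial (Fin n) ℚ} {m : Fin n →₀ ℕ}
    (hg : IsLexLead g m) : IsLexLead (rename Fin.succ g) (Finsupp.cons 0 m) :=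
  IsLexLead.cons (c := 0) (by simp [finSuccEquiv_rename_succ]) (by simp [finSuccEquiv_rename_succ])
    hg

theorem isLexLead_one (n : ℕ) : IsLexLead (1 : MvPolynomial (Fin n) ℚ) 0 := by
  classical
  refine ⟨by simp, fun m' hm' => ?_⟩
  rw [coeff_one] at hm'
  have : 0 = m' := by by_contra h; simp [h] at hm'
  rw [this]

/-! ### Leading monomials of the ideal of complete symmetric polynomials -/

theorem finSuccEquiv_hsymm (n d : ℕ) :
    (MvPolynomial.finSuccEquiv ℚ n (hsymm (Fin (n + 1)) ℚ d)).natDegree ≤ d ∧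
      (MvPolynomial.finSuccEquiv ℚ n (hsymm (Fin (n + 1)) ℚ d)).coeff d = 1 := by
  induction d with
  | zero => simp
  | succ d ih =>
    rw [hsymm_succ, map_add, map_mul, finSuccEquiv_rename_succ, finSuccEquiv_X_zero]
    constructor
    · refine (Polynomial.natDegree_add_le _ _).trans (max_le (by simp) ?_)
      refine Polynomial.natDegree_mul_le.trans ?_
      have := ih.1
      rw [Polynomial.natDegree_X]
      omega
    · rw [Polynomial.coeff_add, Polynomial.coeff_X_mul, ih.2, Polynomial.coeff_C_succ, zero_add]

/-- The ideal generated by `h_{k+1}, …, h_{k+n}` in `n` variables. -/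
def hIdeal (n k : ℕ) : Ideal (MvPolynomial (Fin n) ℚ) :=
  Ideal.span ((fun d => hsymm (Fin n) ℚ d) '' Set.Icc (k + 1) (k + n))

theorem hIdeal_map_le (n k : ℕ) :
    (hIdeal n (k + 1)).map (rename (R := ℚ) (Fin.succ (n := n))) ≤ hIdeal (n + 1) k := by
  rw [hIdeal, Ideal.map_span, Ideal.span_le]
  rintro _ ⟨_, ⟨d, ⟨hd1, hd2⟩, rfl⟩, rfl⟩
  obtain ⟨d, rfl⟩ : ∃ e, d = e + 1 := ⟨d - 1, by omega⟩
  have h := hsymm_succ n d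
  rw [← sub_eq_iff_eq_add] at h
  change rename Fin.succ (hsymm (Fin n) ℚ (d + 1)) ∈ _
  rw [← h]
  refine Ideal.sub_mem _ (Ideal.subset_span ⟨d + 1, ⟨by omega, by omega⟩, rfl⟩)
    (Ideal.mul_mem_left _ _ (Ideal.subset_span ⟨d, ⟨by omega, by omega⟩, rfl⟩))

/-- The ideal of `h_{k+1}, …, h_{k+n}` contains `h_{k+i+1}(x_i, …)`, whose lexicographic leading
monomial is `x_i^{k+i+1}` (with variables numbered from `0`). -/
theorem exists_isLexLead_hIdeal (n : ℕ) : ∀ (k : ℕ) (i : Fin n),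
    ∃ f ∈ hIdeal n k, IsLexLead f (Finsupp.single i (k + ((i : ℕ) + 1))) := by
  induction n with
  | zero => exact fun k i => i.elim0
  | succ n ih =>
    intro k i
    refine Fin.cases ?_ (fun i => ?_) i
    · refine ⟨_, Ideal.subset_span ⟨k + 1, ⟨le_rfl, by omega⟩, rfl⟩, ?_⟩
      have h := finSuccEquiv_hsymm n (k + 1)
      have := IsLexLead.cons h.1 h.2 (isLexLead_one n)
      simpa [Finsupp.cons_zero_eq_single_zero] using this
    · obtain ⟨f, hf, hlead⟩ := ih (k + 1) i
      refine ⟨rename Fin.succ f, hIdeal_map_le n k (Ideal.mem_map_of_mem _ hf), ?_⟩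
      have := hlead.rename_succ
      rw [Finsupp.cons_zero_single_eq_single_succ] at this
      convert this using 2
      simp only [Fin.val_succ]
      omega

/-! ### Leading monomials of the ideal of elementary symmetric polynomials -/

/-- The elementary symmetric polynomial `e_p` in `n` variables for an integer `p`, being zero for
negative `p`. -/
def esymmInt (n : ℕ) (p : ℤ) : MvPolynomial (Fin n) ℚ :=
  if 0 ≤ p then esymm (Fin n) ℚ p.toNat else 0

theorem esymmInt_of_neg {n : ℕ} {p : ℤ} (h : p < 0) : esymmInt n p = 0 := if_neg (by omega)

theorem esymmInt_natCast (n p : ℕ) : esymmInt n p = esymm (Fin n) ℚ p := by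
  simp [esymmInt]

theorem esymmInt_succ (n : ℕ) (p : ℤ) :
    esymmInt (n + 1) p =
      rename Fin.succ (esymmInt n p) + X 0 * rename Fin.succ (esymmInt n (p - 1)) := by
  rcases lt_or_ge p 0 with h | h
  · simp [esymmInt_of_neg h, esymmInt_of_neg (show p - 1 < 0 by omega)]
  · obtain ⟨p, rfl⟩ := Int.eq_ofNat_of_zero_le h
    rcases p with _ | p
    · rw [esymmInt_of_neg (show ((0 : ℕ) : ℤ) - 1 < 0 by omega), esymmInt_natCast, esymmInt_natCast]
      simp
    · rw [show ((p + 1 : ℕ) : ℤ) - 1 = (p : ℕ) by push_cast; ring]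
      simp only [esymmInt_natCast, esymm_succ]

/-- The `c × c` matrix with rows `(e_{P i}, e_{P i + 1}, …, e_{P i + c - 1})`. -/
def esymmMatrix (n c : ℕ) (P : Fin c → ℤ) : Matrix (Fin c) (Fin c) (MvPolynomial (Fin n) ℚ) :=
  Matrix.of fun i j => esymmInt n (P i + (j : ℕ))

/-- The ideal generated by the `c × c` minors of the Toeplitz matrix with rows
`(e_p, …, e_{p+c-1})`, `p ≥ m - c + 1`. For `c = 1` it is generated by the `e_p` with `p ≥ m`. -/
def minorIdeal (n c m : ℕ) : Ideal (MvPolynomial (Fin n) ℚ) :=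
  Ideal.span ((fun P => (esymmMatrix n c P).det) '' {P | ∀ i, (m : ℤ) - c + 1 ≤ P i})

/-- Adding `x` times each column of a `(c+1)`-minor in the variables other than `x` to the next
column turns all columns but the first into the ones for the full set of variables, so an
expansion along the first column writes the minor in terms of `c`-minors. -/
theorem minorIdeal_map_le (n c m : ℕ) :
    (minorIdeal n (c + 1) m).map (rename (R := ℚ) (Fin.succ (n := n))) ≤
      minorIdeal (n + 1) c m := by
  rw [minorIdeal, Ideal.map_span, Ideal.span_le]
  rintro _ ⟨_, ⟨Q, hQ, rfl⟩, rfl⟩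
  change rename Fin.succ (esymmMatrix n (c + 1) Q).det ∈ minorIdeal (n + 1) c m
  rw [AlgHom.map_det, Matrix.det_eq_of_forall_col_eq_smul_add_pred (c := fun _ => -X 0)
    (B := Matrix.of fun i j => Fin.cases (rename Fin.succ (esymmInt n (Q i)))
      (fun j : Fin c => esymmInt (n + 1) (Q i + 1 + (j : ℕ))) j), Matrix.det_succ_column_zero]
  · refine Ideal.sum_mem _ fun i _ => Ideal.mul_mem_left _ _ (Ideal.subset_span ?_)
    refine ⟨fun l => Q (i.succAbove l) + 1, fun l => ?_, ?_⟩
    · have := hQ (i.succAbove l)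
      push_cast at this
      change _ ≤ Q (i.succAbove l) + 1
      omega
    · congr 1
  · intro i
    simp [esymmMatrix]
  · intro i j
    simp only [esymmMatrix, AlgHom.mapMatrix_apply, Matrix.map_apply, Matrix.of_apply,
      Fin.cases_succ, esymmInt_succ]
    rw [show Q i + ((j.succ : Fin (c + 1)) : ℕ) = Q i + 1 + (j : ℕ) by simp; ring,
      show Q i + 1 + (j : ℕ) - 1 = Q i + ((j.castSucc : Fin (c + 1)) : ℕ) by simp; ring]
    ring

/-- Multiplying an element of the minor ideal in the variables other than `x` by `x ^ c` gives
the top part, with respect to `x`, of an element of the minor ideal in all variables. -/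
theorem exists_leadingCoeff_minorIdeal (n c m : ℕ) {g : MvPolynomial (Fin n) ℚ}
    (hg : g ∈ minorIdeal n c m) :
    ∃ f ∈ minorIdeal (n + 1) c (m + 1), (MvPolynomial.finSuccEquiv ℚ n f).natDegree ≤ c ∧
      (MvPolynomial.finSuccEquiv ℚ n f).coeff c = g := by
  refine Submodule.span_induction ?_ ?_ ?_ ?_ hg
  · rintro _ ⟨P, hP, rfl⟩
    refine ⟨(esymmMatrix (n + 1) c fun i => P i + 1).det,
      Ideal.subset_span ⟨_, fun i => ?_, rfl⟩, ?_⟩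
    · have := hP i
      push_cast
      omega
    have key : MvPolynomial.finSuccEquiv ℚ n (esymmMatrix (n + 1) c fun i => P i + 1).det =
        ((Polynomial.X : Polynomial (MvPolynomial (Fin n) ℚ)) •
          (esymmMatrix n c P).map Polynomial.C +
          (esymmMatrix n c fun i => P i + 1).map Polynomial.C).det := by
      rw [AlgEquiv.map_det]
      congr 1
      ext1 i j
      simp only [esymmMatrix, AlgEquiv.mapMatrix_apply, Matrix.map_apply, Matrix.of_apply,
        esymmInt_succ, map_add, map_mul, finSuccEquiv_rename_succ, finSuccEquiv_X_zero,
        Matrix.add_apply, Matrix.smul_apply, smul_eq_mul]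
      rw [add_comm, show P i + 1 + (j : ℕ) - 1 = P i + (j : ℕ) by ring]
    rw [key]
    refine ⟨?_, ?_⟩
    · simpa using Polynomial.natDegree_det_X_add_C_le (esymmMatrix n c P)
        (esymmMatrix n c fun i => P i + 1)
    · simpa using Polynomial.coeff_det_X_add_C_card (esymmMatrix n c P)
        (esymmMatrix n c fun i => P i + 1)
  · exact ⟨0, Ideal.zero_mem _, by simp, by simp⟩
  · rintro a b - - ⟨f, hf, h1, h2⟩ ⟨f', hf', h1', h2'⟩
    refine ⟨f + f', Ideal.add_mem _ hf hf', ?_, by simp [h2, h2']⟩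
    rw [map_add]
    exact (Polynomial.natDegree_add_le _ _).trans (max_le h1 h1')
  · rintro a b - ⟨f, hf, h1, h2⟩
    refine ⟨rename Fin.succ a * f, Ideal.mul_mem_left _ _ hf, ?_, ?_⟩
    · rw [map_mul, finSuccEquiv_rename_succ]
      exact (Polynomial.natDegree_C_mul_le _ _).trans h1
    · rw [map_mul, finSuccEquiv_rename_succ, Polynomial.coeff_C_mul, h2, smul_eq_mul]

/-- For `m = 0` one of the minors is triangular with diagonal entries `e_0 = 1`. -/
theorem minorIdeal_zero (n c : ℕ) : minorIdeal n c 0 = ⊤ := by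
  rw [Ideal.eq_top_iff_one]
  refine Ideal.subset_span ⟨fun i => -(i : ℕ), fun i => ?_, ?_⟩
  · have := i.2
    push_cast
    omega
  · change (esymmMatrix n c _).det = 1
    rw [Matrix.det_of_isUpperTriangular]
    · refine Finset.prod_eq_one fun i _ => ?_
      simpa [esymmMatrix] using esymmInt_natCast n 0
    · intro i j hij
      have : (j : ℕ) < (i : ℕ) := hij
      exact esymmInt_of_neg (show -((i : ℕ) : ℤ) + (j : ℕ) < 0 by omega)

/-- The exponent vector of `∏ x_s^{s + c - #{t ∈ S, t < s}}`, the product over the `s ∈ S`. For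
`c = 1` it is that of the skip monomial of `S`. -/
def skipExponent {n : ℕ} (c : ℕ) (S : Finset (Fin n)) : Fin n →₀ ℕ :=
  Finsupp.equivFunOnFinite.symm fun i =>
    if i ∈ S then (i : ℕ) + c - (S.filter (· < i)).card else 0

theorem skipExponent_map_succ {n : ℕ} (c : ℕ) (S : Finset (Fin n)) :
    skipExponent c (S.map (Fin.succEmb n)) = Finsupp.cons 0 (skipExponent (c + 1) S) := by
  ext i
  refine Fin.cases ?_ (fun i => ?_) i
  · simp [skipExponent]
  · simp [skipExponent, Finset.filter_map, Function.comp_def]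
    grind

theorem skipExponent_insert_zero {n : ℕ} (c : ℕ) (S : Finset (Fin n)) :
    skipExponent c (insert 0 (S.map (Fin.succEmb n))) = Finsupp.cons c (skipExponent c S) := by
  ext i
  refine Fin.cases ?_ (fun i => ?_) i
  · simp [skipExponent]
  · simp only [skipExponent, Finsupp.equivFunOnFinite_symm_apply_apply, Finsupp.cons_succ]
    rw [Finset.filter_insert, if_pos (Fin.succ_pos i), Finset.card_insert_of_notMem (by simp)]
    simp [Finset.filter_map, Function.comp_def]
    grind

/-- The minor ideal contains an element with leading monomial `x(S) ∏_{s ∈ S} x_s^{c-1}`, for each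
`S` with `m` elements. -/
theorem exists_isLexLead_minorIdeal (n : ℕ) : ∀ (c m : ℕ) (S : Finset (Fin n)), 0 < c →
    S.card = m → ∃ f ∈ minorIdeal n c m, IsLexLead f (skipExponent c S) := by
  induction n with
  | zero =>
    rintro c m S - rfl
    obtain rfl := Subsingleton.elim S ∅
    refine ⟨1, by rw [Finset.card_empty, minorIdeal_zero]; trivial, ?_⟩
    rw [show skipExponent c ∅ = 0 from Subsingleton.elim _ _]
    exact isLexLead_one 0
  | succ n ih =>
    rintro c m S hc rfl
    by_cases h0 : (0 : Fin (n + 1)) ∈ S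
    · obtain ⟨T, rfl⟩ : ∃ T : Finset (Fin n), S = insert 0 (T.map (Fin.succEmb n)) := by
        refine ⟨Finset.univ.filter fun i => i.succ ∈ S, ?_⟩
        ext i
        refine Fin.cases (by simp [h0]) (fun i => ?_) i
        simp
      obtain ⟨g, hg, hlead⟩ := ih c T.card T hc rfl
      obtain ⟨f, hf, h1, h2⟩ := exists_leadingCoeff_minorIdeal n c T.card hg
      refine ⟨f, ?_, ?_⟩
      · rwa [Finset.card_insert_of_notMem (by simp), Finset.card_map]
      · rw [skipExponent_insert_zero]
        exact IsLexLead.cons h1 h2 hlead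
    · obtain ⟨T, rfl⟩ : ∃ T : Finset (Fin n), S = T.map (Fin.succEmb n) := by
        refine ⟨Finset.univ.filter fun i => i.succ ∈ S, ?_⟩
        ext i
        refine Fin.cases (by simp [h0]) (fun i => ?_) i
        simp
      obtain ⟨g, hg, hlead⟩ := ih (c + 1) T.card T (by omega) rfl
      refine ⟨rename Fin.succ g, ?_, ?_⟩
      · rw [Finset.card_map]
        exact minorIdeal_map_le n c _ (Ideal.mem_map_of_mem _ hg)
      · rw [skipExponent_map_succ]
        exact hlead.rename_succ

theorem minorIdeal_one_le (n k r : ℕ) : minorIdeal n 1 (n - r + 1) ≤ idealI n k r := by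
  rw [minorIdeal, Ideal.span_le]
  rintro _ ⟨P, hP, rfl⟩
  obtain ⟨p, hp⟩ : ∃ p : ℕ, P 0 = p := by
    have := hP 0
    push_cast at this
    exact Int.eq_ofNat_of_zero_le (by omega)
  have h1 := hP 0
  push_cast [hp] at h1
  have : (esymmMatrix n 1 P).det = esymm (Fin n) ℚ p := by
    simp [esymmMatrix, hp, esymmInt_natCast]
  change (esymmMatrix n 1 P).det ∈ _
  rw [this]
  rcases le_or_gt p n with h | h
  · exact Ideal.subset_span (Or.inr ⟨p, ⟨by omega, h⟩, rfl⟩)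
  · rw [esymm, Finset.powersetCard_eq_empty.mpr (by simpa using h)]
    simp

theorem hIdeal_le (n k r : ℕ) : hIdeal n k ≤ idealI n k r :=
  Ideal.span_mono Set.subset_union_left

/-! ### Good monomials by exponent vectors -/

theorem skipMonomial_eq_monomial {n : ℕ} (S : Finset (Fin n)) :
    skipMonomial S = monomial (skipExponent 1 S) 1 := by
  rw [monomial_eq, map_one, one_mul, Finsupp.prod_fintype _ _ (by simp), skipMonomial]
  simp only [skipExponent, Finsupp.equivFunOnFinite_symm_apply_apply]
  rw [← Finset.prod_subset (Finset.subset_univ S) fun i _ hi => by rw [if_neg hi, pow_zero]]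
  exact Finset.prod_congr rfl fun i hi => by rw [if_pos hi]

theorem mem_goodMonomials {n k r : ℕ} {m : Fin n →₀ ℕ} :
    m ∈ goodMonomials n k r ↔
      (∀ S : Finset (Fin n), S.card = n - r + 1 → ¬ skipExponent 1 S ≤ m) ∧
        ∀ i : Fin n, m i < k + ((i : ℕ) + 1) := by
  simp only [goodMonomials, skipMonomial_eq_monomial, monomial_dvd_monomial, X_pow_eq_monomial,
    Set.mem_ofPred_eq, one_ne_zero, false_or, dvd_refl, and_true, Finsupp.single_le_iff, not_le]

theorem mem_standardMonomials {n : ℕ} {I : Ideal (MvPolynomial (Fin n) ℚ)} {m : Fin n →₀ ℕ} :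
    m ∈ standardMonomials MonomialOrder.lex I ↔
      ∀ f ∈ I, f ≠ 0 → ¬ MonomialOrder.lex.degree f ≤ m := by
  refine forall₃_congr fun f _ hf => not_congr ?_
  rw [MonomialOrder.leadingTerm, monomial_dvd_monomial]
  have : MonomialOrder.lex.leadingCoeff f ∣ 1 :=
    (MonomialOrder.lex.leadingCoeff_ne_zero_iff.mpr hf).isUnit.dvd
  simp only [one_ne_zero, false_or, this, and_true]

/-- The ideal has elements with leading monomials `x(S)` and `x_i^{k+i}`. -/
theorem standardMonomials_subset (n k r : ℕ) :
    standardMonomials MonomialOrder.lex (idealI n k r) ⊆ goodMonomials n k r := by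
  intro m hm
  rw [mem_standardMonomials] at hm
  refine mem_goodMonomials.mpr ⟨fun S hS hle => ?_, fun i => ?_⟩
  · obtain ⟨f, hf, hlead⟩ := exists_isLexLead_minorIdeal n 1 _ S one_pos hS
    exact hm f (minorIdeal_one_le n k r hf) hlead.ne_zero (hlead.degree_eq.symm ▸ hle)
  · by_contra h
    obtain ⟨f, hf, hlead⟩ := exists_isLexLead_hIdeal n k i
    refine hm f (hIdeal_le n k r hf) hlead.ne_zero ?_
    rw [hlead.degree_eq, Finsupp.single_le_iff]
    omega

/-! ### Good exponent vectors and their last entry -/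

/-- `x(S)` divides the monomial with exponents `m`. -/
def SkipDvd {n : ℕ} (S : Finset (Fin n)) (m : Fin n → ℕ) : Prop :=
  ∀ i ∈ S, (i : ℕ) + 1 - (S.filter (· < i)).card ≤ m i

theorem skipExponent_le_iff {n : ℕ} {S : Finset (Fin n)} {m : Fin n →₀ ℕ} :
    skipExponent 1 S ≤ m ↔ SkipDvd S m := by
  refine forall_congr' fun i => ?_
  by_cases h : i ∈ S <;> simp [skipExponent, h]

/-- The monomial with exponents `m` is divisible by no `x(S)` with `|S| = t`. -/
def SkipFree (n t : ℕ) (m : Fin n → ℕ) : Prop :=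
  ∀ S : Finset (Fin n), S.card = t → ¬ SkipDvd S m

theorem skipDvd_map_castSucc {n : ℕ} (T : Finset (Fin n)) (m : Fin (n + 1) → ℕ) :
    SkipDvd (T.map Fin.castSuccEmb) m ↔ SkipDvd T (Fin.init m) := by
  simp [SkipDvd, Finset.filter_map, Function.comp_def, Fin.init]

theorem skipDvd_insert_last {n : ℕ} (T : Finset (Fin n)) (m : Fin (n + 1) → ℕ) :
    SkipDvd (insert (Fin.last n) (T.map Fin.castSuccEmb)) m ↔
      n + 1 - T.card ≤ m (Fin.last n) ∧ SkipDvd T (Fin.init m) := by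
  have hlt : ∀ i : Fin n, ¬ Fin.last n < i.castSucc := fun i => (Fin.castSucc_lt_last i).not_gt
  simp [SkipDvd, Finset.filter_insert, Finset.filter_map, Function.comp_def, Fin.init, hlt]

/-- Removing the largest element of `S` gives a divisor of `x(S)`. -/
theorem SkipDvd.exists_subset {n : ℕ} {S : Finset (Fin n)} {m : Fin n → ℕ} {u : ℕ}
    (h : SkipDvd S m) (hS : S.card = u + 1) : ∃ T : Finset (Fin n), T.card = u ∧ SkipDvd T m := by
  have hne : S.Nonempty := Finset.card_pos.mp (by omega)
  -- The exponents of `x(S)` other than the last one do not depend on the largest element of `S`.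
  refine ⟨S.erase (S.max' hne), by rw [Finset.card_erase_of_mem (S.max'_mem hne)]; omega, ?_⟩
  intro i hi
  convert h i (Finset.mem_of_mem_erase hi) using 3
  rw [Finset.filter_erase, Finset.erase_eq_of_notMem]
  simp only [Finset.mem_filter, not_and, not_lt]
  exact fun _ => S.le_max' i (Finset.mem_of_mem_erase hi)

/-- In `x(S)` with `|S| = u + 1`, the last variable occurs with exponent `n + 1 - u` or not at all,
so its exponent in `m` decides which condition remains on the other variables. -/
theorem skipFree_succ {n u : ℕ} (m : Fin (n + 1) → ℕ) :
    SkipFree (n + 1) (u + 1) m ↔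
      if m (Fin.last n) < n + 1 - u then SkipFree n (u + 1) (Fin.init m)
      else SkipFree n u (Fin.init m) := by
  have key : SkipFree (n + 1) (u + 1) m ↔ SkipFree n (u + 1) (Fin.init m) ∧
      (n + 1 - u ≤ m (Fin.last n) → SkipFree n u (Fin.init m)) := by
    constructor
    · intro h
      refine ⟨fun T hT hdvd => ?_, fun hle T hT hdvd => ?_⟩
      · exact h _ (by rw [Finset.card_map, hT]) ((skipDvd_map_castSucc T m).mpr hdvd)
      · refine h _ ?_ ((skipDvd_insert_last T m).mpr ⟨by rwa [hT], hdvd⟩)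
        rw [Finset.card_insert_of_notMem (by simp [Fin.castSucc_ne_last]), Finset.card_map, hT]
    · rintro ⟨h1, h2⟩ S hS hdvd
      by_cases hl : Fin.last n ∈ S
      · obtain ⟨T, rfl⟩ : ∃ T : Finset (Fin n),
            S = insert (Fin.last n) (T.map Fin.castSuccEmb) := by
          refine ⟨Finset.univ.filter fun i => i.castSucc ∈ S, ?_⟩
          ext i
          refine Fin.lastCases (by simp [hl]) (fun i => ?_) i
          simp [Fin.castSucc_ne_last]
        rw [Finset.card_insert_of_notMem (by simp [Fin.castSucc_ne_last]), Finset.card_map] at hS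
        obtain ⟨h3, h4⟩ := (skipDvd_insert_last T m).mp hdvd
        exact h2 (by rwa [show T.card = u by omega] at h3) T (by omega) h4
      · obtain ⟨T, rfl⟩ : ∃ T : Finset (Fin n), S = T.map Fin.castSuccEmb := by
          refine ⟨Finset.univ.filter fun i => i.castSucc ∈ S, ?_⟩
          ext i
          refine Fin.lastCases (by simp [hl, Fin.castSucc_ne_last]) (fun i => ?_) i
          simp
        exact h1 T (by simpa using hS) ((skipDvd_map_castSucc T m).mp hdvd)
  rw [key]
  split_ifs with h
  · exact ⟨fun h' => h'.1, fun h' => ⟨h', fun h'' => absurd h (by omega)⟩⟩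
  · refine ⟨fun h' => h'.2 (by omega), fun h' => ⟨fun S hS hdvd => ?_, fun _ => h'⟩⟩
    obtain ⟨T, hT, hdvd'⟩ := hdvd.exists_subset hS
    exact h' T hT hdvd'

/-- The exponent vectors of the `(n,k,r)`-good monomials, as functions. -/
def goodVectors (n k r : ℕ) : Set (Fin n → ℕ) :=
  {m | SkipFree n (n - r + 1) m ∧ ∀ i : Fin n, m i < k + ((i : ℕ) + 1)}

theorem mem_goodMonomials_iff {n k r : ℕ} {m : Fin n →₀ ℕ} :
    m ∈ goodMonomials n k r ↔ ⇑m ∈ goodVectors n k r := by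
  rw [mem_goodMonomials]
  simp only [skipExponent_le_iff]
  rfl

/-! ### Words and codes -/

/-- The words of length `N` that are rearrangements of `{0^k, 1, …, n}`. -/
def wordSet (N n k : ℕ) : Set (Fin N → ℕ) :=
  {w | Finset.univ.val.map w = Multiset.replicate k 0 + (Finset.Icc 1 n).val}

/-- The code of a word of arbitrary length, as a function. -/
def codeVector (N n : ℕ) (w : Fin N → ℕ) : Fin n → ℕ := fun i =>
  {q : Fin N | w q < (i : ℕ) + 1 ∧ ∃ p < q, w p = (i : ℕ) + 1}.ncard

theorem wordSet_le {N n k : ℕ} {w : Fin N → ℕ} (hw : w ∈ wordSet N n k) (q : Fin N) : w q ≤ n := by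
  have h : w q ∈ Finset.univ.val.map w := Multiset.mem_map_of_mem w (Finset.mem_univ q)
  rw [show Finset.univ.val.map w = _ from hw, Multiset.mem_add, Multiset.mem_replicate] at h
  rcases h with h | h
  · omega
  · exact (Finset.mem_Icc.mp h).2

theorem card_pos_letters {N n k : ℕ} {w : Fin N → ℕ} (hw : w ∈ wordSet N n k) :
    (Finset.univ.filter fun q => 0 < w q).card = n := by
  have h := congrArg (Multiset.countP fun a => 0 < a) (show Finset.univ.val.map w = _ from hw)
  rw [Multiset.countP_add, Multiset.countP_map,
    Multiset.countP_eq_zero.mpr fun a ha => by rw [Multiset.eq_of_mem_replicate ha]; omega,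
    Multiset.countP_eq_card (p := fun a => 0 < a).mpr fun a ha => Nat.pos_of_ne_zero fun h0 => by
      simp [h0] at ha,
    Finset.card_val, Nat.card_Icc] at h
  change (Finset.univ.val.filter fun q => 0 < w q).card = n
  omega

/-- A tail of `r` positive letters needs `r ≤ n`, there being only `n` positive letters. -/
theorem card_tail_le {N n k r : ℕ} {w : Fin N → ℕ} (hw : w ∈ wordSet N n k) (hr : r ≤ N)
    (h : IsTailPositive r w) : r ≤ n := by
  rw [← card_pos_letters hw]
  have hsub : (Finset.univ : Finset (Fin r)).image
      (fun j : Fin r => (⟨N - r + j, by omega⟩ : Fin N)) ⊆ Finset.univ.filter fun q => 0 < w q := by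
    intro q hq
    obtain ⟨j, -, rfl⟩ := Finset.mem_image.mp hq
    exact Finset.mem_filter.mpr ⟨Finset.mem_univ _, h _ (Nat.le_add_right _ _)⟩
  have hcard := Finset.card_le_card hsub
  rwa [Finset.card_image_of_injective _ (fun a b hab => by
    simpa [Fin.ext_iff] using hab), Finset.card_univ, Fintype.card_fin] at hcard

theorem insertNth_mem_wordSet {N n k : ℕ} (p : Fin (N + 1)) (w : Fin N → ℕ) :
    (p.insertNth (n + 1) w : Fin (N + 1) → ℕ) ∈ wordSet (N + 1) (n + 1) k ↔ w ∈ wordSet N n k := by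
  have h1 : Finset.univ.val.map (p.insertNth (n + 1) w : Fin (N + 1) → ℕ) =
      (n + 1) ::ₘ Finset.univ.val.map w := by
    rw [Fin.univ_succAbove N p, Finset.cons_val, Multiset.map_cons, Finset.map_val,
      Multiset.map_map, Fin.insertNth_apply_same]
    congr 1
    exact Multiset.map_congr rfl fun q _ => by simp
  have h2 : (Finset.Icc 1 (n + 1)).val = (n + 1) ::ₘ (Finset.Icc 1 n).val := by
    rw [show Finset.Icc 1 (n + 1) = insert (n + 1) (Finset.Icc 1 n) by ext; simp; omega,
      Finset.insert_val_of_notMem (by simp)]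
  change _ = _ ↔ _ = _
  rw [h1, h2, Multiset.add_cons, Multiset.cons_inj_right]

theorem exists_insertNth_of_mem_wordSet {N n k : ℕ} {w : Fin (N + 1) → ℕ}
    (hw : w ∈ wordSet (N + 1) (n + 1) k) :
    ∃ p : Fin (N + 1), ∃ w' ∈ wordSet N n k, w = p.insertNth (n + 1) w' := by
  have h : n + 1 ∈ Finset.univ.val.map w := by
    rw [show Finset.univ.val.map w = _ from hw]
    exact Multiset.mem_add.mpr (Or.inr (by simp))
  obtain ⟨p, -, hp⟩ := Multiset.mem_map.mp h
  have hw' : w = p.insertNth (n + 1) (p.removeNth w) := by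
    rw [← hp, Fin.insertNth_self_removeNth]
  exact ⟨p, p.removeNth w, (insertNth_mem_wordSet p _).mp (hw' ▸ hw), hw'⟩

theorem codeVector_insertNth {N n : ℕ} (p : Fin (N + 1)) {w : Fin N → ℕ} (hw : ∀ q, w q ≤ n) :
    codeVector (N + 1) (n + 1) (p.insertNth (n + 1) w) =
      Fin.snoc (α := fun _ => ℕ) (codeVector N n w) (N - p) := by
  funext i
  refine Fin.lastCases ?_ (fun i => ?_) i
  · have : {q : Fin (N + 1) | (p.insertNth (n + 1) w : Fin (N + 1) → ℕ) q < n + 1 ∧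
        ∃ p' < q, (p.insertNth (n + 1) w : Fin (N + 1) → ℕ) p' = n + 1} =
          (Finset.Ioi p : Set _) := by
      ext q
      simp only [Set.mem_ofPred_eq, Finset.coe_Ioi, Set.mem_Ioi]
      constructor
      · rintro ⟨-, p', hlt, hp'⟩
        rcases Fin.eq_self_or_eq_succAbove p p' with rfl | ⟨j, rfl⟩
        · exact hlt
        · rw [Fin.insertNth_apply_succAbove] at hp'
          have := hw j
          omega
      · intro hlt
        refine ⟨?_, p, hlt, by simp⟩
        obtain ⟨j, rfl⟩ := Fin.exists_succAbove_eq hlt.ne'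
        rw [Fin.insertNth_apply_succAbove]
        have := hw j
        omega
    simp only [codeVector, Fin.snoc_last, Fin.val_last]
    rw [this, Set.ncard_coe_finset, Fin.card_Ioi]
    omega
  · simp only [codeVector, Fin.snoc_castSucc, Fin.val_castSucc]
    rw [← Set.ncard_image_of_injective _ (Fin.succAbove_right_injective (p := p))]
    congr 1
    have hi := i.2
    ext q
    simp only [Set.mem_ofPred_eq, Set.mem_image]
    constructor
    · rintro ⟨hq, p', hlt, hp'⟩
      rcases Fin.eq_self_or_eq_succAbove p q with rfl | ⟨j, rfl⟩
      · rw [Fin.insertNth_apply_same] at hq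
        omega
      rcases Fin.eq_self_or_eq_succAbove p p' with rfl | ⟨l, rfl⟩
      · rw [Fin.insertNth_apply_same] at hp'
        omega
      rw [Fin.insertNth_apply_succAbove] at hp' hq
      exact ⟨j, ⟨hq, l, (Fin.strictMono_succAbove p).lt_iff_lt.mp hlt, hp'⟩, rfl⟩
    · rintro ⟨j, ⟨hq, l, hlt, hl⟩, rfl⟩
      exact ⟨by simpa using hq, p.succAbove l, Fin.strictMono_succAbove p hlt, by simpa using hl⟩

theorem isTailPositive_insertNth {N n r : ℕ} (p : Fin (N + 1)) (w : Fin N → ℕ) :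
    IsTailPositive r (p.insertNth (n + 1) w : Fin (N + 1) → ℕ) ↔
      if N - (p : ℕ) < r then IsTailPositive (r - 1) w else IsTailPositive r w := by
  rw [IsTailPositive, Fin.forall_iff_succAbove p]
  simp only [Fin.insertNth_apply_same, Fin.insertNth_apply_succAbove, Nat.succ_pos, implies_true,
    true_and]
  have hp := p.2
  have hval : ∀ q : Fin N, ((p.succAbove q : Fin (N + 1)) : ℕ) =
      if (q : ℕ) < p then (q : ℕ) else q + 1 := by
    intro q
    simp only [Fin.succAbove, Fin.lt_def, Fin.val_castSucc]
    split_ifs <;> simp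
  split_ifs with h
  · refine forall_congr' fun q => imp_congr_left ?_
    rw [hval]
    split_ifs <;> omega
  · refine forall_congr' fun q => imp_congr_left ?_
    rw [hval]
    split_ifs <;> omega

/-- Without the tail condition, codes are all the vectors below `(k+1, …, k+n)`. -/
theorem bijOn_codeVector (n : ℕ) : ∀ N k : ℕ, N = n + k →
    Set.BijOn (codeVector N n) (wordSet N n k) {m | ∀ i : Fin n, m i < k + ((i : ℕ) + 1)} := by
  induction n with
  | zero =>
    intro N k hN
    refine ⟨fun w _ i => i.elim0, fun w hw w' hw' _ => ?_, fun m _ => ⟨fun _ => 0, ?_, ?_⟩⟩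
    · funext q
      have h1 := wordSet_le hw q
      have h2 := wordSet_le hw' q
      omega
    · change Finset.univ.val.map _ = _
      rw [Multiset.map_const']
      simp [hN]
    · exact Subsingleton.elim _ _
  | succ n ih =>
    intro N k hN
    obtain ⟨N, rfl⟩ : ∃ N', N = N' + 1 := ⟨n + k, by omega⟩
    obtain ⟨hmaps, hinj, hsurj⟩ := ih N k (by omega)
    refine ⟨fun w hw => ?_, fun w₁ hw₁ w₂ hw₂ heq => ?_, fun m hm => ?_⟩
    · obtain ⟨p, w', hw', rfl⟩ := exists_insertNth_of_mem_wordSet hw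
      rw [codeVector_insertNth p (wordSet_le hw')]
      intro i
      refine Fin.lastCases ?_ (fun i => ?_) i
      · simp only [Fin.snoc_last, Fin.val_last]
        omega
      · simpa using hmaps hw' i
    · obtain ⟨p₁, w₁', hw₁', rfl⟩ := exists_insertNth_of_mem_wordSet hw₁
      obtain ⟨p₂, w₂', hw₂', rfl⟩ := exists_insertNth_of_mem_wordSet hw₂
      rw [codeVector_insertNth p₁ (wordSet_le hw₁'), codeVector_insertNth p₂ (wordSet_le hw₂'),
        Fin.snoc_inj] at heq
      have hp : p₁ = p₂ := by
        have h1 := p₁.2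
        have h2 := p₂.2
        have h3 := heq.2
        ext
        omega
      rw [hp, hinj hw₁' hw₂' heq.1]
    · have hinit : Fin.init m ∈ {m : Fin n → ℕ | ∀ i : Fin n, m i < k + ((i : ℕ) + 1)} :=
        fun i => by simpa [Fin.init] using hm i.castSucc
      obtain ⟨w', hw', hcode⟩ := hsurj hinit
      have hlast := hm (Fin.last n)
      rw [Fin.val_last] at hlast
      refine ⟨(⟨N - m (Fin.last n), by omega⟩ : Fin (N + 1)).insertNth (n + 1) w',
        (insertNth_mem_wordSet _ _).mpr hw', ?_⟩
      rw [codeVector_insertNth _ (wordSet_le hw'), hcode]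
      change Fin.snoc (α := fun _ => ℕ) _ (N - (N - m (Fin.last n))) = m
      rw [show N - (N - m (Fin.last n)) = m (Fin.last n) by omega, Fin.snoc_init_self]

/-- The tail condition on a word is the skip condition on its code. -/
theorem isTailPositive_iff_skipFree (n : ℕ) : ∀ N k r : ℕ, N = n + k → r ≤ n →
    ∀ w ∈ wordSet N n k, (IsTailPositive r w ↔ SkipFree n (n - r + 1) (codeVector N n w)) := by
  induction n with
  | zero =>
    intro N k r hN hr w _
    refine ⟨fun _ S hS => ?_, fun _ p hp => ?_⟩
    · rw [Subsingleton.elim S ∅] at hS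
      simp at hS
    · have := p.2
      omega
  | succ n ih =>
    intro N k r hN hr w hw
    obtain ⟨N, rfl⟩ : ∃ N', N = N' + 1 := ⟨n + k, by omega⟩
    obtain ⟨p, w', hw', rfl⟩ := exists_insertNth_of_mem_wordSet hw
    rw [codeVector_insertNth p (wordSet_le hw'), isTailPositive_insertNth, skipFree_succ,
      Fin.snoc_last, Fin.init_snoc, show n + 1 - (n + 1 - r) = r by omega]
    split_ifs with h
    · rw [ih N k (r - 1) (by omega) (by omega) w' hw', show n - (r - 1) = n + 1 - r by omega]
    · rcases hr.lt_or_eq with hr' | rfl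
      · rw [ih N k r (by omega) (by omega) w' hw', show n - r + 1 = n + 1 - r by omega]
      · -- Only `n` letters of `w'` are positive, and every monomial is divisible by `x(∅) = 1`.
        refine iff_of_false (fun htail => ?_) fun hfree => ?_
        · have := card_tail_le hw' (by omega) htail
          omega
        · exact hfree ∅ (by simp) (by simp [SkipDvd])

theorem bijOn_code (n k r : ℕ) (hr : r ≤ n) :
    Set.BijOn (code n k) (tailPositiveWords n k r) (goodMonomials n k r) := by
  obtain ⟨hmaps, hinj, hsurj⟩ := bijOn_codeVector n (n + k) k rfl
  have htail := isTailPositive_iff_skipFree n (n + k) k r rfl hr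
  have hcoe : ∀ w, ⇑(code n k w) = codeVector (n + k) n w := fun w => rfl
  refine ⟨fun w hw => ?_, fun w hw w' hw' heq => ?_, fun m hm => ?_⟩
  · rw [mem_goodMonomials_iff, hcoe]
    exact ⟨(htail w hw.1).mp hw.2, hmaps hw.1⟩
  · exact hinj hw.1 hw'.1 (congrArg DFunLike.coe heq)
  · rw [mem_goodMonomials_iff] at hm
    obtain ⟨w, hw, hcode⟩ := hsurj hm.2
    refine ⟨w, ⟨hw, (htail w hw).mpr (hcode ▸ hm.1)⟩, DFunLike.coe_injective ?_⟩
    rw [hcoe, hcode]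

/-! ### Linear independence from a degeneration -/

/-- The polynomials all of whose monomials have degree less than `d`. -/
def lowDegree (n d : ℕ) : Submodule ℚ (MvPolynomial (Fin n) ℚ) :=
  restrictSupport ℚ {m | m.degree < d}

theorem mem_lowDegree {n d : ℕ} {f : MvPolynomial (Fin n) ℚ} :
    f ∈ lowDegree n d ↔ ∀ m, coeff m f ≠ 0 → m.degree < d := by
  rw [lowDegree, mem_restrictSupport_iff]
  exact forall_congr' fun m => by simp

theorem mem_lowDegree_totalDegree {n : ℕ} (f : MvPolynomial (Fin n) ℚ) :
    f ∈ lowDegree n (f.totalDegree + 1) :=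
  mem_lowDegree.mpr fun m hm => Nat.lt_succ_of_le <| by
    simpa [Finsupp.degree_eq_sum, Finsupp.sum_fintype] using le_totalDegree (mem_support_iff.mpr hm)

theorem sub_homogeneousComponent_mem_lowDegree {n d : ℕ} {f : MvPolynomial (Fin n) ℚ}
    (hf : f ∈ lowDegree n (d + 1)) : f - homogeneousComponent d f ∈ lowDegree n d := by
  rw [mem_lowDegree] at hf ⊢
  intro m hm
  rw [coeff_sub, coeff_homogeneousComponent] at hm
  split_ifs at hm with h
  · simp at hm
  · have := hf m (by simpa using hm)
    omega

section Degeneration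

variable {n : ℕ} {I : Ideal (MvPolynomial (Fin n) ℚ)} {M : Set (Fin n →₀ ℕ)}
  {V : Type*} [AddCommGroup V] [Module ℚ V] (ev : MvPolynomial (Fin n) ℚ →ₗ[ℚ] V)

/-- If on homogeneous elements of `I` the map `ev` agrees with `ev` of polynomials of lower degree,
then monomials spanning the quotient by `I` degree by degree also span the image of `ev`. -/
theorem map_mem_span_of_degeneration
    (hspan : ∀ f d, ∃ g ∈ restrictSupport ℚ {m | m ∈ M ∧ m.degree = d},
      homogeneousComponent d f - g ∈ I)
    (hev : ∀ f ∈ I, ∀ d, ∃ g ∈ lowDegree n d, ev (homogeneousComponent d f) = ev g) (d : ℕ) :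
    ∀ f ∈ lowDegree n d,
      ev f ∈ (restrictSupport ℚ {m | m ∈ M ∧ m.degree < d}).map ev := by
  induction d with
  | zero =>
    intro f hf
    have : f = 0 := by
      ext m
      by_contra h
      exact absurd (mem_lowDegree.mp hf m (by simpa using h)) (by omega)
    rw [this, map_zero]
    exact Submodule.zero_mem _
  | succ d ih =>
    intro f hf
    have hmono : (restrictSupport ℚ {m | m ∈ M ∧ m.degree < d}).map ev ≤
        (restrictSupport ℚ {m | m ∈ M ∧ m.degree < d + 1}).map ev :=
      Submodule.map_mono (restrictSupport_mono ℚ fun m hm => ⟨hm.1, hm.2.trans (by omega)⟩)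
    obtain ⟨g, hg, hgI⟩ := hspan f d
    obtain ⟨g', hg', hgev⟩ := hev _ hgI d
    have hcomp : homogeneousComponent d (homogeneousComponent d f - g) =
        homogeneousComponent d f - g := by
      ext m
      rw [coeff_homogeneousComponent]
      split_ifs with h
      · rfl
      · rw [coeff_sub, coeff_homogeneousComponent, if_neg h, zero_sub, eq_comm, neg_eq_zero]
        by_contra hm
        exact h (((mem_restrictSupport_iff ℚ).mp hg) (mem_support_iff.mpr hm)).2
    rw [hcomp] at hgev
    have hsum : ev f = ev (f - homogeneousComponent d f) + (ev g' + ev g) := by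
      rw [← hgev, ← map_add, ← map_add]
      congr 1
      ring
    rw [hsum]
    refine Submodule.add_mem _ (hmono (ih _ (sub_homogeneousComponent_mem_lowDegree hf)))
      (Submodule.add_mem _ (hmono (ih _ hg')) ?_)
    exact Submodule.mem_map_of_mem
      (restrictSupport_mono ℚ (fun m (hm : m ∈ M ∧ m.degree = d) =>
        show m ∈ M ∧ m.degree < d + 1 from ⟨hm.1, by omega⟩) hg)

theorem map_restrictSupport (s : Set (Fin n →₀ ℕ)) :
    (restrictSupport ℚ s).map ev = Submodule.span ℚ ((fun m => ev (monomial m 1)) '' s) := by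
  rw [restrictSupport_eq_span, Submodule.map_span, Set.image_image]

/-- Monomials spanning the quotient by `I` degree by degree, as many as the dimension of the space
onto which `ev` maps, are linearly independent modulo `I`. -/
theorem linearIndependent_quotMap_of_degeneration [Fintype M]
    (hspan : ∀ f d, ∃ g ∈ restrictSupport ℚ {m | m ∈ M ∧ m.degree = d},
      homogeneousComponent d f - g ∈ I)
    (hev : ∀ f ∈ I, ∀ d, ∃ g ∈ lowDegree n d, ev (homogeneousComponent d f) = ev g)
    (hsurj : Function.Surjective ev) (hcard : Fintype.card M = Module.finrank ℚ V) :
    LinearIndependent ℚ fun m : M => quotMap I (monomial (m : Fin n →₀ ℕ) 1) := by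
  have key := map_mem_span_of_degeneration ev hspan hev
  have himage : ∀ p : (Fin n →₀ ℕ) → Prop,
      (fun m => ev (monomial m 1)) '' {m | m ∈ M ∧ p m} =
        (fun m : M => ev (monomial (m : Fin n →₀ ℕ) 1)) '' {m | p m} := by
    intro p
    ext v
    simp only [Set.mem_image, Set.mem_ofPred_eq, Subtype.exists, exists_and_left]
    grind
  have hLI : LinearIndependent ℚ fun m : M => ev (monomial (m : Fin n →₀ ℕ) 1) := by
    refine linearIndependent_of_top_le_span_of_card_eq_finrank (fun v _ => ?_) hcard
    obtain ⟨f, rfl⟩ := hsurj v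
    have := key _ f (mem_lowDegree_totalDegree f)
    rw [map_restrictSupport, himage] at this
    exact Submodule.span_mono (Set.image_subset_range _ _) this
  rw [linearIndependent_iff]
  intro l hl
  by_contra hne
  obtain ⟨m₀, hm₀, hmax⟩ := l.support.exists_max_image (fun m => (m : Fin n →₀ ℕ).degree)
    (Finsupp.support_nonempty_iff.mpr hne)
  set d := (m₀ : Fin n →₀ ℕ).degree
  set f := Finsupp.linearCombination ℚ (fun m : M => monomial (m : Fin n →₀ ℕ) (1 : ℚ)) l with hf
  have hfI : f ∈ I := by
    have h : quotMap I f = 0 := by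
      rw [hf, Finsupp.apply_linearCombination]
      exact hl
    exact Ideal.Quotient.eq_zero_iff_mem.mp h
  have hflow : f ∈ lowDegree n (d + 1) := by
    rw [hf, Finsupp.linearCombination_apply]
    refine Submodule.sum_mem _ fun m hm => Submodule.smul_mem _ _ ?_
    exact (monomial_mem_restrictSupport ℚ).mpr (Or.inl (Nat.lt_succ_of_le (hmax m hm)))
  -- Modulo lower degree, `f` is its component of degree `d`, which lies in `I`.
  have hmem : ev f ∈ (restrictSupport ℚ {m | m ∈ M ∧ m.degree < d}).map ev := by
    obtain ⟨g, hg, hgev⟩ := hev f hfI d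
    have : ev f = ev (f - homogeneousComponent d f) + ev g := by
      rw [← hgev, ← map_add, sub_add_cancel]
    rw [this]
    exact Submodule.add_mem _ (key d _ (sub_homogeneousComponent_mem_lowDegree hflow)) (key d g hg)
  rw [map_restrictSupport, himage, Finsupp.mem_span_image_iff_linearCombination] at hmem
  obtain ⟨l', hl', heq⟩ := hmem
  rw [hf, Finsupp.apply_linearCombination] at heq
  rw [hLI heq] at hl'
  exact lt_irrefl d (hl' hm₀)

end Degeneration

/-! ### The points of a word and generating functions -/

theorem aeval_rename_succ {n : ℕ} (x : Fin (n + 1) → ℚ) (f : MvPolynomial (Fin n) ℚ) :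
    aeval x (rename Fin.succ f) = aeval (fun i => x i.succ) f := by
  rw [aeval_rename]
  rfl

theorem mk_aeval_esymm (n : ℕ) : ∀ x : Fin n → ℚ,
    PowerSeries.mk (fun d => aeval x (esymm (Fin n) ℚ d)) =
      ∏ i, (1 + PowerSeries.C (x i) * PowerSeries.X) := by
  induction n with
  | zero =>
    intro x
    ext d
    rcases d with _ | d
    · simp
    · rw [PowerSeries.coeff_mk, esymm, Finset.powersetCard_eq_empty.mpr (by simp)]
      simp [PowerSeries.coeff_one]
  | succ n ih =>
    intro x
    rw [Fin.prod_univ_succ, ← ih]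
    ext d
    rw [add_mul, one_mul, map_add, mul_assoc, PowerSeries.coeff_C_mul]
    rcases d with _ | d
    · simp
    · rw [PowerSeries.coeff_succ_X_mul]
      simp only [PowerSeries.coeff_mk, esymm_succ, map_add, map_mul, aeval_X, aeval_rename_succ]

theorem mk_aeval_hsymm_mul (n : ℕ) : ∀ x : Fin n → ℚ,
    PowerSeries.mk (fun d => aeval x (hsymm (Fin n) ℚ d)) *
      ∏ i, (1 + PowerSeries.C (-x i) * PowerSeries.X) = 1 := by
  induction n with
  | zero =>
    intro x
    ext d
    rcases d with _ | d <;> simp [PowerSeries.coeff_one, hsymm_fin_zero]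
  | succ n ih =>
    intro x
    rw [Fin.prod_univ_succ, ← mul_assoc]
    refine Eq.trans (congrArg (· * _) ?_) (ih fun i => x i.succ)
    ext d
    rw [mul_add (PowerSeries.mk _) 1, mul_one, map_add, mul_left_comm, PowerSeries.coeff_C_mul]
    rcases d with _ | d
    · simp
    · rw [PowerSeries.coeff_succ_mul_X]
      simp only [PowerSeries.coeff_mk, hsymm_succ, map_add, map_mul, aeval_X, aeval_rename_succ]
      ring

theorem coeff_prod_one_add_eq_zero {ι : Type*} (s : Finset ι) (a : ι → ℚ) {d : ℕ}
    (hd : s.card < d) :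
    PowerSeries.coeff d (∏ q ∈ s, (1 + PowerSeries.C (a q) * PowerSeries.X)) = 0 := by
  classical
  induction s using Finset.induction_on generalizing d with
  | empty =>
    rw [Finset.prod_empty, PowerSeries.coeff_one, if_neg (by simp at hd; omega)]
  | insert q s hq ih =>
    rw [Finset.card_insert_of_notMem hq] at hd
    obtain ⟨d, rfl⟩ : ∃ e, d = e + 1 := ⟨d - 1, by omega⟩
    rw [Finset.prod_insert hq, add_mul, one_mul, map_add, mul_assoc, PowerSeries.coeff_C_mul,
      PowerSeries.coeff_succ_X_mul, ih (by omega), ih (by omega)]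
    simp

/-- If the coefficient of `t^d` in `(∑ φ_j(x) t^j) G(t)` vanishes for all points `x` in a set, where
`G(0) = 1`, then `φ_d` agrees on this set with a polynomial of lower degree. -/
theorem exists_lowDegree_of_coeff_mul_eq_zero {n : ℕ} {φ : ℕ → MvPolynomial (Fin n) ℚ}
    (hφ : ∀ j, φ j ∈ lowDegree n (j + 1)) {G : PowerSeries ℚ}
    (hG : PowerSeries.constantCoeff G = 1) (d : ℕ) :
    ∃ g ∈ lowDegree n d, ∀ x : Fin n → ℚ,
      PowerSeries.coeff d (PowerSeries.mk (fun j => aeval x (φ j)) * G) = 0 →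
        aeval x (φ d) = aeval x g := by
  refine ⟨-∑ j ∈ Finset.range d, PowerSeries.coeff (d - j) G • φ j,
    Submodule.neg_mem _ (Submodule.sum_mem _ fun j hj => Submodule.smul_mem _ _ ?_), fun x hx => ?_⟩
  · have := Finset.mem_range.mp hj
    exact restrictSupport_mono ℚ
      (fun m (hm : m.degree < j + 1) => show m.degree < d by omega) (hφ j)
  · rw [PowerSeries.coeff_mul, Finset.Nat.sum_antidiagonal_eq_sum_range_succ
      (fun i j => PowerSeries.coeff i (PowerSeries.mk fun j => aeval x (φ j)) *
        PowerSeries.coeff j G), Finset.sum_range_succ, Nat.sub_self,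
      PowerSeries.coeff_zero_eq_constantCoeff_apply, hG, mul_one, PowerSeries.coeff_mk] at hx
    rw [map_neg, map_sum, eq_neg_iff_add_eq_zero, add_comm, ← hx]
    congr 1
    refine Finset.sum_congr rfl fun j _ => ?_
    rw [map_smul, PowerSeries.coeff_mk, smul_eq_mul, mul_comm]

theorem exists_positions {N n k : ℕ} {w : Fin N → ℕ} (hw : w ∈ wordSet N n k) :
    ∃ pos : Fin n → Fin N, Function.Injective pos ∧ (∀ i, w (pos i) = (i : ℕ) + 1) ∧
      Finset.univ.image pos = Finset.univ.filter fun q => 0 < w q := by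
  have h : ∀ i : Fin n, ∃ q, w q = (i : ℕ) + 1 := by
    intro i
    have h : (i : ℕ) + 1 ∈ Finset.univ.val.map w := by
      rw [show Finset.univ.val.map w = _ from hw]
      exact Multiset.mem_add.mpr (Or.inr (by simp))
    obtain ⟨q, -, hq⟩ := Multiset.mem_map.mp h
    exact ⟨q, hq⟩
  choose pos hpos using h
  have hinj : Function.Injective pos := by
    intro i j hij
    have h1 := hpos i
    rw [hij, hpos j] at h1
    exact Fin.ext (by omega)
  refine ⟨pos, hinj, hpos, Finset.eq_of_subset_of_card_le ?_ ?_⟩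
  · intro q hq
    obtain ⟨i, -, rfl⟩ := Finset.mem_image.mp hq
    simp [hpos]
  · rw [card_pos_letters hw, Finset.card_image_of_injective _ hinj]
    simp

/-- The position of the letter `i + 1` in a word. -/
def letterPosition {N n k : ℕ} {w : Fin N → ℕ} (hw : w ∈ wordSet N n k) : Fin n → Fin N :=
  (exists_positions hw).choose

/-- The point with coordinates the positions of the positive letters of a word. -/
def wordPoint {N n k : ℕ} {w : Fin N → ℕ} (hw : w ∈ wordSet N n k) (i : Fin n) : ℚ :=
  ((letterPosition hw i : ℕ) : ℚ)

theorem wordPoint_injective {N n k : ℕ} {w w' : Fin N → ℕ} (hw : w ∈ wordSet N n k)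
    (hw' : w' ∈ wordSet N n k) (h : wordPoint hw = wordPoint hw') : w = w' := by
  have hpos : letterPosition hw = letterPosition hw' := by
    funext i
    have := congrFun h i
    simp only [wordPoint, Nat.cast_inj] at this
    exact Fin.ext this
  obtain ⟨-, h1, h2⟩ := (exists_positions hw).choose_spec
  obtain ⟨-, h1', h2'⟩ := (exists_positions hw').choose_spec
  change ∀ i, w (letterPosition hw i) = _ at h1
  change Finset.univ.image (letterPosition hw) = _ at h2
  change ∀ i, w' (letterPosition hw' i) = _ at h1'
  change Finset.univ.image (letterPosition hw') = _ at h2'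
  rw [← hpos] at h1' h2'
  funext q
  by_cases hq : q ∈ Finset.univ.image (letterPosition hw)
  · obtain ⟨i, -, rfl⟩ := Finset.mem_image.mp hq
    rw [h1, h1']
  · have hq1 := hq
    rw [h2] at hq
    rw [h2'] at hq1
    simp only [Finset.mem_filter, Finset.mem_univ, true_and, not_lt, nonpos_iff_eq_zero] at hq hq1
    rw [hq, hq1]

theorem prod_wordPoint {N n k : ℕ} {w : Fin N → ℕ} (hw : w ∈ wordSet N n k)
    (F : ℚ → PowerSeries ℚ) :
    ∏ i, F (wordPoint hw i) = ∏ q ∈ Finset.univ.filter (fun q => 0 < w q), F ((q : ℕ) : ℚ) := by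
  obtain ⟨h1, -, h2⟩ := (exists_positions hw).choose_spec
  rw [← h2, Finset.prod_image fun a _ b _ hab => h1 hab]
  rfl

/-- Multiplied by `∏ (1 - q t)` over all positions `q`, the generating function of the complete
symmetric polynomials becomes the product over the `k` positions of the letter `0`. -/
theorem coeff_mk_aeval_hsymm_mul {n k d : ℕ} {w : Fin (n + k) → ℕ} (hw : w ∈ wordSet (n + k) n k)
    (hd : k < d) :
    PowerSeries.coeff d (PowerSeries.mk (fun j => aeval (wordPoint hw) (hsymm (Fin n) ℚ j)) *
      ∏ q : Fin (n + k), (1 + PowerSeries.C (-((q : ℕ) : ℚ)) * PowerSeries.X)) = 0 := by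
  rw [← Finset.prod_filter_mul_prod_filter_not _ (fun q => 0 < w q),
    ← prod_wordPoint hw fun x => 1 + PowerSeries.C (-x) * PowerSeries.X, ← mul_assoc,
    mk_aeval_hsymm_mul, one_mul]
  apply coeff_prod_one_add_eq_zero
  have h := Finset.card_filter_add_card_filter_not (s := Finset.univ) fun q => 0 < w q
  rw [card_pos_letters hw, Finset.card_univ, Fintype.card_fin] at h
  omega

/-- Divided by `∏ (1 + q t)` over the last `r` positions `q`, which carry positive letters, the
generating function of the elementary symmetric polynomials becomes a product of `n - r` factors. -/
theorem coeff_mk_aeval_esymm_mul {n k r d : ℕ} {w : Fin (n + k) → ℕ} (hw : w ∈ wordSet (n + k) n k)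
    (htail : IsTailPositive r w) (hr : r ≤ n) (hd : n - r < d) :
    PowerSeries.coeff d (PowerSeries.mk (fun j => aeval (wordPoint hw) (esymm (Fin n) ℚ j)) *
      (∏ q ∈ Finset.univ.filter (fun q : Fin (n + k) => n + k - r ≤ (q : ℕ)),
        (1 + PowerSeries.C ((q : ℕ) : ℚ) * PowerSeries.X))⁻¹) = 0 := by
  have hsub : Finset.univ.filter (fun q : Fin (n + k) => n + k - r ≤ (q : ℕ)) ⊆
      Finset.univ.filter fun q => 0 < w q := by
    intro q hq
    simp only [Finset.mem_filter, Finset.mem_univ, true_and] at hq ⊢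
    exact htail q hq
  rw [mk_aeval_esymm, prod_wordPoint hw fun x => 1 + PowerSeries.C x * PowerSeries.X,
    ← Finset.prod_sdiff hsub, mul_assoc, PowerSeries.mul_inv_cancel, mul_one]
  · apply coeff_prod_one_add_eq_zero
    rw [Finset.card_sdiff_of_subset hsub, card_pos_letters hw]
    have : (Finset.univ.filter (fun q : Fin (n + k) => n + k - r ≤ (q : ℕ))).card = r := by
      have h := Finset.card_filter_add_card_filter_not (s := Finset.univ)
        fun q : Fin (n + k) => (q : ℕ) < n + k - r
      simp only [not_lt, Fin.card_filter_val_lt, Finset.card_univ, Fintype.card_fin] at h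
      omega
    omega
  · simp

/-! ### The ideal and the functions on the set of words -/

/-- Evaluation of polynomials at the points of the `r`-tail positive words. -/
def evalWords (n k r : ℕ) : MvPolynomial (Fin n) ℚ →ₐ[ℚ] (tailPositiveWords n k r → ℚ) :=
  AlgHom.pi fun w => aeval (wordPoint (k := k) w.2.1)

theorem evalWords_apply {n k r : ℕ} (f : MvPolynomial (Fin n) ℚ) (w : tailPositiveWords n k r) :
    evalWords n k r f w = aeval (wordPoint (k := k) w.2.1) f := rfl

theorem evalWords_surjective (n k r : ℕ) [Finite (tailPositiveWords n k r)] :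
    Function.Surjective (evalWords n k r) := by
  classical
  have := Fintype.ofFinite (tailPositiveWords n k r)
  -- A product of differences `X_i - b_i` gives a function supported at a single word.
  have hsep : ∀ w w' : tailPositiveWords n k r, w ≠ w' → ∃ f, evalWords n k r f w ≠ 0 ∧
      evalWords n k r f w' = 0 := by
    intro w w' hne
    have : wordPoint (k := k) w.2.1 ≠ wordPoint (k := k) w'.2.1 := fun h =>
      hne (Subtype.ext (wordPoint_injective w.2.1 w'.2.1 h))
    obtain ⟨i, hi⟩ := Function.ne_iff.mp this
    refine ⟨X i - C (wordPoint (k := k) w'.2.1 i), ?_, ?_⟩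
    · simpa [evalWords_apply, sub_eq_zero] using hi
    · simp [evalWords_apply]
  choose! F hF1 hF2 using hsep
  have hdelta : ∀ w : tailPositiveWords n k r,
      ∃ f, evalWords n k r f = Pi.single w 1 := by
    intro w
    set f := ∏ w' ∈ Finset.univ.erase w, F w w' with hf
    have h1 : evalWords n k r f w ≠ 0 := by
      rw [hf, map_prod, Finset.prod_apply, Finset.prod_ne_zero_iff]
      exact fun w' hw' => hF1 w w' (Finset.ne_of_mem_erase hw').symm
    refine ⟨(evalWords n k r f w)⁻¹ • f, funext fun w' => ?_⟩
    rw [map_smul, Pi.smul_apply, smul_eq_mul]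
    rcases eq_or_ne w' w with rfl | hne
    · rw [inv_mul_cancel₀ h1, Pi.single_eq_same]
    · have h2 : evalWords n k r f w' = 0 := by
        rw [hf, map_prod, Finset.prod_apply]
        exact Finset.prod_eq_zero (Finset.mem_erase.mpr ⟨hne, Finset.mem_univ w'⟩)
          (hF2 w w' hne.symm)
      rw [Pi.single_eq_of_ne hne, h2, mul_zero]
  choose f hf using hdelta
  intro v
  refine ⟨∑ w, v w • f w, ?_⟩
  rw [map_sum]
  simp_rw [map_smul, hf]
  funext w
  simp [Finset.sum_apply, Pi.single_apply]

/-- Multiplication by a monomial shifts homogeneous components. -/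
theorem homogeneousComponent_monomial_mul {n d : ℕ} (s : Fin n →₀ ℕ) (c : ℚ)
    (f : MvPolynomial (Fin n) ℚ) :
    homogeneousComponent d (monomial s c * f) =
      if s.degree ≤ d then monomial s c * homogeneousComponent (d - s.degree) f else 0 := by
  ext t
  have hdeg : s ≤ t → t.degree = s.degree + (t - s).degree := fun h => by
    rw [← map_add, add_tsub_cancel_of_le h]
  rw [coeff_homogeneousComponent, coeff_monomial_mul']
  split_ifs with h1 h2 h3 h3 h3
  · rw [coeff_monomial_mul', if_pos h2, coeff_homogeneousComponent, if_pos]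
    have := hdeg h2
    omega
  · have := hdeg h2
    omega
  · rw [coeff_monomial_mul', if_neg h2]
  · rfl
  · rw [coeff_monomial_mul', coeff_homogeneousComponent]
    split_ifs with h4 h5
    · have := hdeg h4
      omega
    · rw [mul_zero]
    · rfl
  · rfl

theorem homogeneousComponent_eq_self_or_zero {n e : ℕ} {f : MvPolynomial (Fin n) ℚ}
    (hf : f.IsHomogeneous e) (d : ℕ) :
    homogeneousComponent d f = if d = e then f else 0 :=
  homogeneousComponent_of_mem hf

theorem esymm_isHomogeneous (n d : ℕ) : (esymm (Fin n) ℚ d).IsHomogeneous d := by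
  refine IsHomogeneous.sum _ _ _ fun t ht => ?_
  have h := IsHomogeneous.prod t (fun i => (X i : MvPolynomial (Fin n) ℚ)) (fun _ => 1)
    (fun i _ => isHomogeneous_X ℚ i)
  simpa [(Finset.mem_powersetCard.mp ht).2] using h

theorem hsymm_isHomogeneous (n d : ℕ) : (hsymm (Fin n) ℚ d).IsHomogeneous d := by
  refine IsHomogeneous.sum _ _ _ fun s _ => ?_
  have key : ∀ t : Multiset (Fin n),
      ((t.map (X : Fin n → MvPolynomial (Fin n) ℚ)).prod).IsHomogeneous (Multiset.card t) := by
    intro t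
    induction t using Multiset.induction_on with
    | empty => simpa using isHomogeneous_one (Fin n) ℚ
    | cons a t ih =>
      rw [Multiset.map_cons, Multiset.prod_cons, Multiset.card_cons, add_comm]
      exact (isHomogeneous_X ℚ a).mul ih
  have h := key s.1
  rwa [s.2] at h

theorem mem_lowDegree_of_isHomogeneous {n d : ℕ} {f : MvPolynomial (Fin n) ℚ}
    (hf : f.IsHomogeneous d) : f ∈ lowDegree n (d + 1) := by
  refine mem_lowDegree.mpr fun m hm => ?_
  have := hf hm
  rw [Finsupp.degree_eq_weight_one]
  exact Nat.lt_succ_of_le this.le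

/-- At the points of the tail positive words, homogeneous elements of the ideal agree with
polynomials of lower degree. -/
theorem exists_lowDegree_evalWords {n k r : ℕ} (hr : r ≤ n) :
    ∀ f ∈ idealI n k r, ∀ d, ∃ g ∈ lowDegree n d,
      evalWords n k r (homogeneousComponent d f) = evalWords n k r g := by
  intro f hf
  refine Submodule.span_induction ?_ ?_ ?_ ?_ hf
  · have aux : ∀ (e : ℕ) (φ : ℕ → MvPolynomial (Fin n) ℚ) (hφ : ∀ j, (φ j).IsHomogeneous j)
        (G : PowerSeries ℚ) (hG : PowerSeries.constantCoeff G = 1)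
        (hcoeff : ∀ w : tailPositiveWords n k r, PowerSeries.coeff e
          (PowerSeries.mk (fun j => aeval (wordPoint (k := k) w.2.1) (φ j)) * G) = 0),
        ∀ d, ∃ g ∈ lowDegree n d,
          evalWords n k r (homogeneousComponent d (φ e)) = evalWords n k r g := by
      intro e φ hφ G hG hcoeff d
      rw [homogeneousComponent_eq_self_or_zero (hφ e)]
      split_ifs with h
      · subst h
        obtain ⟨g, hg, hgev⟩ :=
          exists_lowDegree_of_coeff_mul_eq_zero
            (fun j => mem_lowDegree_of_isHomogeneous (hφ j)) hG d
        exact ⟨g, hg, funext fun w => hgev _ (hcoeff w)⟩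
      · exact ⟨0, Submodule.zero_mem _, rfl⟩
    rintro _ (⟨e, ⟨he, -⟩, rfl⟩ | ⟨e, ⟨he, -⟩, rfl⟩)
    · exact aux e (hsymm (Fin n) ℚ) (hsymm_isHomogeneous n) _ (by simp [map_prod])
        fun w => coeff_mk_aeval_hsymm_mul w.2.1 (by omega)
    · exact aux e (esymm (Fin n) ℚ) (esymm_isHomogeneous n) _ (by simp [map_prod])
        fun w => coeff_mk_aeval_esymm_mul w.2.1 w.2.2 hr (by omega)
  · exact fun d => ⟨0, Submodule.zero_mem _, by simp⟩
  · intro a b _ _ ha hb d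
    obtain ⟨g, hg, h⟩ := ha d
    obtain ⟨g', hg', h'⟩ := hb d
    exact ⟨g + g', Submodule.add_mem _ hg hg', by rw [map_add, map_add, map_add, h, h']⟩
  · intro a b _ hb
    induction a using MvPolynomial.induction_on' with
    | monomial s c =>
      intro d
      rw [smul_eq_mul, homogeneousComponent_monomial_mul]
      split_ifs with hs
      · obtain ⟨g, hg, h⟩ := hb (d - s.degree)
        refine ⟨monomial s c * g, mem_lowDegree.mpr fun m hm => ?_, by rw [map_mul, map_mul, h]⟩
        rw [coeff_monomial_mul'] at hm
        split_ifs at hm with hle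
        · have h1 := mem_lowDegree.mp hg _ (right_ne_zero_of_mul hm)
          have h2 : m.degree = s.degree + (m - s).degree := by
            rw [← map_add, add_tsub_cancel_of_le hle]
          omega
        · exact absurd rfl hm
      · exact ⟨0, Submodule.zero_mem _, rfl⟩
    | add p q hp hq =>
      intro d
      obtain ⟨g, hg, h⟩ := hp d
      obtain ⟨g', hg', h'⟩ := hq d
      exact ⟨g + g', Submodule.add_mem _ hg hg', by
        rw [add_smul, map_add, map_add, map_add, h, h']⟩

/-! ### The generating function of good monomials -/

open Classical in
/-- The generating function by degree of the exponent vectors below `(k+1, …, k+n)` that are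
divisible by no `x(S)` with `|S| = t`. -/
def skipFreeSeries (n k t : ℕ) : PowerSeries ℚ :=
  ∑ m ∈ Fintype.piFinset (fun i : Fin n => Finset.range (k + ((i : ℕ) + 1))),
    if SkipFree n t m then PowerSeries.X ^ (∑ i, m i) else 0

theorem skipFreeSeries_zero (n k : ℕ) : skipFreeSeries n k 0 = 0 := by
  refine Finset.sum_eq_zero fun m _ => if_neg fun h => ?_
  exact h ∅ rfl (by simp [SkipDvd])

theorem skipFreeSeries_succ {n k u : ℕ} (hu : u ≤ n + 1) :
    skipFreeSeries (n + 1) k (u + 1) = qNumber (n + 1 - u) * skipFreeSeries n k (u + 1) +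
      PowerSeries.X ^ (n + 1 - u) * (qNumber (k + u) * skipFreeSeries n k u) := by
  classical
  have hsplit : skipFreeSeries (n + 1) k (u + 1) = ∑ c ∈ Finset.range ((n + 1 - u) + (k + u)),
      PowerSeries.X ^ c *
        if c < n + 1 - u then skipFreeSeries n k (u + 1) else skipFreeSeries n k u := by
    have hterm : ∀ c, (PowerSeries.X ^ c *
        if c < n + 1 - u then skipFreeSeries n k (u + 1) else skipFreeSeries n k u) =
        ∑ m ∈ Fintype.piFinset (fun i : Fin n => Finset.range (k + ((i : ℕ) + 1))),
          if SkipFree (n + 1) (u + 1) (Fin.snoc (α := fun _ => ℕ) m c) then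
            (PowerSeries.X : PowerSeries ℚ) ^ (∑ i, Fin.snoc (α := fun _ => ℕ) m c i) else 0 := by
      intro c
      simp only [skipFree_succ, Fin.snoc_last, Fin.init_snoc, Fin.sum_univ_castSucc,
        Fin.snoc_castSucc]
      split_ifs <;>
      · rw [skipFreeSeries, Finset.mul_sum]
        refine Finset.sum_congr rfl fun m _ => ?_
        rw [mul_ite, mul_zero, ← pow_add, add_comm c]
    rw [Finset.sum_congr rfl fun c _ => hterm c, ← Finset.sum_product', skipFreeSeries]
    refine Finset.sum_nbij' (fun m => (m (Fin.last n), Fin.init m))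
      (fun p => Fin.snoc (α := fun _ => ℕ) p.2 p.1) ?_ ?_ ?_ ?_ ?_
    · intro m hm
      rw [Fintype.mem_piFinset] at hm
      simp only [Finset.mem_product, Fintype.mem_piFinset, Finset.mem_range]
      have h := Finset.mem_range.mp (hm (Fin.last n))
      rw [Fin.val_last] at h
      exact ⟨by omega, fun i => by simpa [Fin.init] using hm i.castSucc⟩
    · intro p hp
      simp only [Finset.mem_product, Fintype.mem_piFinset, Finset.mem_range] at hp
      rw [Fintype.mem_piFinset]
      refine fun i => Fin.lastCases ?_ (fun i => ?_) i
      · rw [Fin.snoc_last, Finset.mem_range, Fin.val_last]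
        omega
      · simpa using hp.2 i
    · exact fun m _ => Fin.snoc_init_self m
    · intro p _
      simp
    · intro m _
      simp only [Fin.snoc_init_self]
  rw [hsplit, Finset.sum_range_add, qNumber, qNumber, Finset.sum_mul, Finset.sum_mul,
    Finset.mul_sum]
  congr 1
  · exact Finset.sum_congr rfl fun c hc => by rw [if_pos (Finset.mem_range.mp hc)]
  · exact Finset.sum_congr rfl fun c _ => by rw [if_neg (by omega), pow_add, mul_assoc]

theorem qNumber_add (a b : ℕ) : qNumber (a + b) = qNumber a + PowerSeries.X ^ a * qNumber b := by
  rw [qNumber, Finset.sum_range_add, qNumber, qNumber, Finset.mul_sum]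
  simp only [pow_add]

theorem qFactorial_succ (m : ℕ) : qFactorial (m + 1) = qFactorial m * qNumber (m + 1) :=
  Finset.prod_range_succ _ _

theorem qBinomial_mul (s k : ℕ) :
    qBinomial (s + k) k * (qFactorial k * qFactorial s) = qFactorial (s + k) := by
  rw [qBinomial, if_pos (by omega), Nat.add_sub_cancel, mul_assoc, PowerSeries.inv_mul_cancel,
    mul_one]
  simp [constantCoeff_qFactorial]

theorem qFactorial_ne_zero (m : ℕ) : qFactorial m ≠ 0 := by
  intro h
  have := constantCoeff_qFactorial m
  rw [h, map_zero] at this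
  exact zero_ne_one this

theorem qNumber_mul_qBinomial (s k : ℕ) :
    qNumber (k + (s + 1)) * qBinomial (s + k) k = qNumber (s + 1) * qBinomial (s + 1 + k) k := by
  have h1 := qBinomial_mul s k
  have h2 := qBinomial_mul (s + 1) k
  rw [show s + 1 + k = s + k + 1 by ring, qFactorial_succ, qFactorial_succ, ← h1] at h2
  apply mul_right_cancel₀ (mul_ne_zero (qFactorial_ne_zero k) (qFactorial_ne_zero s))
  rw [show k + (s + 1) = s + k + 1 by ring, show s + 1 + k = s + k + 1 by ring]
  linear_combination -h2

theorem skipFreeSeries_eq (n : ℕ) : ∀ k s : ℕ, s ≤ n →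
    skipFreeSeries n k (s + 1) = qBinomial (s + k) k * qFactorial n := by
  induction n with
  | zero =>
    intro k s hs
    obtain rfl : s = 0 := by omega
    have h : qBinomial (0 + k) k = 1 := by
      have := qBinomial_mul 0 k
      rw [zero_add] at this
      apply mul_right_cancel₀ (qFactorial_ne_zero k)
      simpa [qFactorial] using this
    rw [h, skipFreeSeries, Finset.sum_eq_single 0]
    · rw [if_pos]
      · simp [qFactorial]
      · intro S hS
        rw [Subsingleton.elim S ∅] at hS
        simp at hS
    · exact fun m _ hm => absurd (Subsingleton.elim m 0) hm
    · exact fun h => absurd (Fintype.mem_piFinset.mpr fun i => i.elim0) h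
  | succ n ih =>
    intro k s hs
    have h1 : qNumber (n + 1 - s) * skipFreeSeries n k (s + 1) =
        qNumber (n + 1 - s) * (qBinomial (s + k) k * qFactorial n) := by
      rcases hs.lt_or_eq with h | rfl
      · rw [ih k s (by omega)]
      · simp [qNumber]
    have h2 : qNumber (k + s) * skipFreeSeries n k s =
        qNumber s * (qBinomial (s + k) k * qFactorial n) := by
      rcases s with _ | s
      · simp [skipFreeSeries_zero, qNumber]
      · rw [ih k s (by omega), ← mul_assoc, qNumber_mul_qBinomial, mul_assoc]
    have h3 := qNumber_add (n + 1 - s) s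
    rw [show n + 1 - s + s = n + 1 by omega] at h3
    rw [skipFreeSeries_succ hs, h1, h2, qFactorial_succ, h3]
    ring

theorem coeff_skipFreeSeries (n k r d : ℕ) :
    PowerSeries.coeff d (skipFreeSeries n k (n - r + 1)) =
      ({m : Fin n →₀ ℕ | m ∈ goodMonomials n k r ∧ m.degree = d}.ncard : ℚ) := by
  classical
  have hset : (fun m : Fin n →₀ ℕ => (m : Fin n → ℕ)) ''
      {m | m ∈ goodMonomials n k r ∧ m.degree = d} =
      ((Fintype.piFinset (fun i : Fin n => Finset.range (k + ((i : ℕ) + 1)))).filter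
        fun m => SkipFree n (n - r + 1) m ∧ ∑ i, m i = d : Finset (Fin n → ℕ)) := by
    ext m
    simp only [Set.mem_image, Set.mem_ofPred_eq, mem_goodMonomials_iff, Finset.coe_filter,
      Fintype.mem_piFinset, Finset.mem_range, goodVectors, Finsupp.degree_eq_sum]
    constructor
    · rintro ⟨m, ⟨⟨h1, h2⟩, h3⟩, rfl⟩
      exact ⟨h2, h1, h3⟩
    · rintro ⟨h2, h1, h3⟩
      exact ⟨Finsupp.equivFunOnFinite.symm m, ⟨⟨h1, h2⟩, h3⟩, rfl⟩
  rw [← Set.ncard_image_of_injective _ DFunLike.coe_injective, hset, Set.ncard_coe_finset,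
    skipFreeSeries, map_sum, Finset.card_filter, Nat.cast_sum]
  refine Finset.sum_congr rfl fun m _ => ?_
  rw [apply_ite (PowerSeries.coeff d), PowerSeries.coeff_X_pow, map_zero, ite_and, eq_comm]
  split_ifs <;> grind

/-! ### Standard monomials and the quotient ring -/

/-- Division by all nonzero elements of an ideal leaves a combination of standard monomials. -/
theorem exists_standard_remainder {n : ℕ} (I : Ideal (MvPolynomial (Fin n) ℚ))
    (f : MvPolynomial (Fin n) ℚ) :
    ∃ g ∈ restrictSupport ℚ (standardMonomials MonomialOrder.lex I), f - g ∈ I := by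
  obtain ⟨q, g, hf, -, hg⟩ := MonomialOrder.lex.div_set (B := {b | b ∈ I ∧ b ≠ 0})
    (fun b hb => (MonomialOrder.lex.leadingCoeff_ne_zero_iff.mpr hb.2).isUnit) f
  refine ⟨g, (mem_restrictSupport_iff ℚ).mpr fun m hm => ?_, ?_⟩
  · exact mem_standardMonomials.mpr fun b hb hb0 => hg m hm b ⟨hb, hb0⟩
  · rw [hf, add_sub_cancel_right, Finsupp.linearCombination_apply]
    exact Ideal.sum_mem _ fun b _ => Ideal.mul_mem_left _ _ b.2.1

theorem exists_homogeneous_standard_remainder {n : ℕ} {I : Ideal (MvPolynomial (Fin n) ℚ)}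
    (hI : I.IsHomogeneous (homogeneousSubmodule (Fin n) ℚ)) (f : MvPolynomial (Fin n) ℚ) (d : ℕ) :
    ∃ g ∈ restrictSupport ℚ {m | m ∈ standardMonomials MonomialOrder.lex I ∧ m.degree = d},
      homogeneousComponent d f - g ∈ I := by
  obtain ⟨g, hg, hfg⟩ := exists_standard_remainder I f
  refine ⟨homogeneousComponent d g, (mem_restrictSupport_iff ℚ).mpr fun m hm => ?_, ?_⟩
  · have hm' : coeff m (homogeneousComponent d g) ≠ 0 := mem_support_iff.mp hm
    rw [coeff_homogeneousComponent] at hm'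
    split_ifs at hm' with h
    · exact ⟨(mem_restrictSupport_iff ℚ).mp hg (mem_support_iff.mpr hm'), h⟩
    · exact absurd rfl hm'
  · rw [← map_sub]
    exact homogeneousComponent_mem_of_mem hI hfg d

theorem goodMonomials_finite (n k r : ℕ) : (goodMonomials n k r).Finite := by
  refine (Set.finite_Iic (Finsupp.equivFunOnFinite.symm fun i : Fin n => k + ((i : ℕ) + 1))).subset
    fun m hm i => ?_
  exact ((mem_goodMonomials.mp hm).2 i).le

theorem linearIndependent_goodMonomials {n k r : ℕ} (hr : r ≤ n) :
    LinearIndependent ℚ fun m : goodMonomials n k r =>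
      quotMap (idealI n k r) (monomial (m : Fin n →₀ ℕ) 1) := by
  have hbij := bijOn_code n k r hr
  have := (goodMonomials_finite n k r).fintype
  have : Finite (tailPositiveWords n k r) := hbij.finite_iff_finite.mpr (goodMonomials_finite n k r)
  have := Fintype.ofFinite (tailPositiveWords n k r)
  refine linearIndependent_quotMap_of_degeneration (evalWords n k r).toLinearMap (fun f d => ?_)
    (exists_lowDegree_evalWords hr) (evalWords_surjective n k r) ?_
  · obtain ⟨g, hg, hfg⟩ := exists_homogeneous_standard_remainder (idealI_isHomogeneous n k r) f d
    exact ⟨g, restrictSupport_mono ℚ (Set.inter_subset_inter_left _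
      (standardMonomials_subset n k r)) hg, hfg⟩
  · rw [Module.finrank_fintype_fun_eq_card]
    exact (Fintype.card_congr hbij.equiv).symm

theorem quotMap_eq_of_sub_mem {n : ℕ} {I : Ideal (MvPolynomial (Fin n) ℚ)}
    {f g : MvPolynomial (Fin n) ℚ} (h : f - g ∈ I) : quotMap I f = quotMap I g :=
  Ideal.Quotient.eq.mpr h

theorem standardMonomials_eq {n k r : ℕ} (hr : r ≤ n) :
    standardMonomials MonomialOrder.lex (idealI n k r) = goodMonomials n k r := by
  refine (standardMonomials_subset n k r).antisymm fun m hm => ?_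
  by_contra hms
  -- Otherwise the class of `m` would be a combination of the classes of other good monomials.
  obtain ⟨g, hg, hmg⟩ := exists_standard_remainder (idealI n k r) (monomial m 1)
  refine (linearIndependent_goodMonomials (k := k) hr).notMem_span_image
    (s := {x | (x : Fin n →₀ ℕ) ∈ standardMonomials MonomialOrder.lex (idealI n k r)})
    (x := ⟨m, hm⟩) hms ?_
  have h := Submodule.mem_map_of_mem (f := quotMap (idealI n k r)) hg
  rw [map_restrictSupport] at h
  change quotMap (idealI n k r) (monomial m 1) ∈ _
  rw [quotMap_eq_of_sub_mem hmg]
  refine Submodule.span_mono ?_ h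
  rintro _ ⟨m', hm', rfl⟩
  exact ⟨⟨m', standardMonomials_subset n k r hm'⟩, hm', rfl⟩

theorem span_goodMonomials {n k r : ℕ} :
    ⊤ ≤ Submodule.span ℚ (Set.range fun m : goodMonomials n k r =>
      quotMap (idealI n k r) (monomial (m : Fin n →₀ ℕ) 1)) := by
  intro v _
  obtain ⟨f, rfl⟩ := Ideal.Quotient.mk_surjective v
  obtain ⟨g, hg, hfg⟩ := exists_standard_remainder (idealI n k r) f
  have h := Submodule.mem_map_of_mem (f := quotMap (idealI n k r)) hg
  rw [map_restrictSupport] at h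
  change quotMap (idealI n k r) f ∈ _
  rw [quotMap_eq_of_sub_mem hfg]
  refine Submodule.span_mono ?_ h
  rintro _ ⟨m', hm', rfl⟩
  exact ⟨⟨m', standardMonomials_subset n k r hm'⟩, rfl⟩

theorem finrank_gradedPiece {n k r : ℕ} (hr : r ≤ n) (d : ℕ) :
    Module.finrank ℚ (gradedPiece (idealI n k r) d) =
      {m : Fin n →₀ ℕ | m ∈ goodMonomials n k r ∧ m.degree = d}.ncard := by
  set M := {m : Fin n →₀ ℕ | m ∈ goodMonomials n k r ∧ m.degree = d} with hM
  have : Fintype M := ((goodMonomials_finite n k r).subset fun m hm => hm.1).fintype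
  have hpiece : gradedPiece (idealI n k r) d = Submodule.span ℚ (Set.range fun m : M =>
      quotMap (idealI n k r) (monomial (m : Fin n →₀ ℕ) 1)) := by
    have hrange : (Set.range fun m : M => quotMap (idealI n k r) (monomial (m : Fin n →₀ ℕ) 1)) =
        (fun m => quotMap (idealI n k r) (monomial m 1)) '' M := by
      rw [Set.image_eq_range]
    rw [hrange, ← map_restrictSupport]
    refine le_antisymm ?_ (Submodule.map_mono fun f hf => ?_)
    · rintro _ ⟨f, hf, rfl⟩
      obtain ⟨g, hg, hfg⟩ :=
        exists_homogeneous_standard_remainder (idealI_isHomogeneous n k r) f d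
      rw [homogeneousComponent_eq_self_or_zero hf, if_pos rfl] at hfg
      rw [standardMonomials_eq hr] at hg
      rw [quotMap_eq_of_sub_mem hfg]
      exact Submodule.mem_map_of_mem hg
    · intro m hm
      have h : m.degree = d := ((mem_restrictSupport_iff ℚ).mp hf (mem_support_iff.mpr hm)).2
      rwa [Finsupp.degree_eq_weight_one] at h
  have hLI : LinearIndependent ℚ fun m : M =>
      quotMap (idealI n k r) (monomial (m : Fin n →₀ ℕ) 1) :=
    (linearIndependent_goodMonomials hr).comp (fun m : M => ⟨m, m.2.1⟩)
      fun a b hab => Subtype.ext (Subtype.mk.inj hab)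
  rw [hpiece, finrank_span_eq_card hLI, ← Nat.card_eq_fintype_card, Nat.card_coe_set_eq]

theorem hilbertSeries_idealI {n k r : ℕ} (hr : r ≤ n) :
    hilbertSeries (idealI n k r) = qBinomial (n + k - r) k * qFactorial n := by
  rw [show n + k - r = n - r + k by omega, ← skipFreeSeries_eq n k (n - r) (Nat.sub_le n r)]
  ext d
  rw [coeff_skipFreeSeries, hilbertSeries, PowerSeries.coeff_mk, finrank_gradedPiece hr]

end

end TailPositive

theorem mainTheorem1 (n k r : ℕ) (hr : r ≤ n) :
    TailPositive.standardMonomials MonomialOrder.lex (TailPositive.idealI n k r) =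
        TailPositive.goodMonomials n k r ∧
      (∃ b : Module.Basis (TailPositive.goodMonomials n k r) ℚ (TailPositive.ringR n k r),
        ∀ m : TailPositive.goodMonomials n k r,
          b m = Ideal.Quotient.mk (TailPositive.idealI n k r)
            (MvPolynomial.monomial (m : Fin n →₀ ℕ) (1 : ℚ))) ∧
      TailPositive.hilbertSeries (TailPositive.idealI n k r) =
        TailPositive.qBinomial (n + k - r) k * TailPositive.qFactorial n ∧
      Set.BijOn (TailPositive.code n k) (TailPositive.tailPositiveWords n k r)
        (TailPositive.goodMonomials n k r) := by
  refine ⟨TailPositive.standardMonomials_eq hr,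
    ⟨Module.Basis.mk (TailPositive.linearIndependent_goodMonomials hr)
      TailPositive.span_goodMonomials, fun m => ?_⟩,
    TailPositive.hilbertSeries_idealI hr, TailPositive.bijOn_code n k r hr⟩
  rw [Module.Basis.mk_apply]
  rfl
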